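/- A supermanifold of dimension $(m,k)$ is a pair $(M,\mathcal A)$, where $M$ is a smooth $m$-manifold and $\mathcal A$ is a sheaf of $\mathbb Z_2$-graded commutative $\mathbb R$-algebras on $M$ with a morphism $\varepsilon\colon\mathcal A\to\mathcal C^\infty_M$, locally isomorphic, compatibly with $\varepsilon$, to the sheaf of sections of the exterior algebra of a rank $k$ vector bundle. The tautological supermanifold of $M$ is $\mathfrak M=(M,\Omega^\bullet_M)$, where $\Omega^\bullet_M$ is the sheaf of smooth sections of $\Lambda^\bullet T^*M$, i.e. of differential forms, and $\varepsilon$ is the projection onto degree $0$. A sub-supermanifold of $(M,\mathcal A)$ is a supermanifold $(N,\mathcal B)$ with a morphism (a smooth map $i\colon N\to M$ and a morphism of sheaves of graded algebras $\mathcal A\to i_*\mathcal B$ compatible with $\varepsilon$) such that $i$ is a smooth embedding and $\mathcal A_{i(y)}\to\mathcal B_y$ is surjective for all $y\in N$. Let $M$ be a smooth manifold of dimension $m$ and $i\colon N\hookrightarrow M$ an embedded submanifold of dimension $n$, and let $\mathfrak M$, $\mathfrak N=(N,\mathcal B)$ be the tautological supermanifolds of $M$ and $N$. Then $\mathfrak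 M$ and $\mathfrak N$ are supermanifolds of dimensions $(m,m)$ and $(n,n)$, and $\mathfrak N$ is, by the pullback of differential forms along $i$, a sub-supermanifold of $\mathfrak M$. Moreover, let $(x^1,\dots,x^m)$ be local coordinates on an open set $U\subset M$, let $\theta^k=dx^k$, and let $V_1,\dots,V_r$ be smooth functions on $U$ such that $N\cap U=\{V_1=\dots=V_r=0\}$ and the Jacobian matrix $(\partial V_a/\partial x^k)$ has rank $m-n$ at every point of $N\cap U$. Then the equations of $\mathfrak N$ in $U$ are $$V_1=\dots=V_r=0,\qquad W_1=\dots=W_r=0,\qquad W_a=\sum_{k=1}^m\frac{\partial V_a}{\partial x^k}\,\theta^k,$$ that is, $N\cap U$ is the set of common zeros of all $\varepsilon(V_a)$ and $\varepsilon(W_a)$, and the sheaf of ideals of the superfunctions on open subsets of $U$ whose pullback to $\mathfrak N$ vanishes is generated by $V_1,\dots,V_r,W_1,\dots,W_r$. -/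

import Mathlib

open scoped Manifold ContDiff
open TopologicalSpace CategoryTheory Opposite

universe u v

noncomputable section

namespace SuperGeom

/-! ### Superspaces, supermanifolds and their morphisms -/

section Abstract

/-- A sheaf of real algebras on a manifold `M` modelled on `ℝ^m`, together with subspaces of even
and odd sections and a morphism of sheaves of algebras `body` (usually written `ε`) to the sheaf of
smooth real functions.  See `IsSupermanifold` for the axioms of a supermanifold. -/
structure Superspace (m : ℕ) (M : Type u) [TopologicalSpace M]
    [ChartedSpace (EuclideanSpace ℝ (Fin m)) M] where
  /-- the structure sheaf -/
  sheaf : TopCat.Sheaf (AlgCat.{u} ℝ) (TopCat.of M)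
  /-- the even (`0`) and the odd (`1`) sections over an open set -/
  parity : ∀ U : Opens M, ZMod 2 → Submodule ℝ (sheaf.presheaf.obj (op U))
  /-- the morphism `ε` to smooth functions -/
  body : ∀ U : Opens M, sheaf.presheaf.obj (op U) →ₐ[ℝ] C^∞⟮𝓡 m, U; ℝ⟯
  body_naturality : ∀ (U V : Opens M) (h : U ≤ V) (f : sheaf.presheaf.obj (op V)) (x : U),
    body U ((sheaf.presheaf.map (homOfLE h).op).hom f) x = body V f ⟨x, h x.2⟩

namespace Superspace

variable {m : ℕ} {M : Type u} [TopologicalSpace M] [ChartedSpace (EuclideanSpace ℝ (Fin m)) M]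

/-- The algebra of superfunctions on the open set `U`. -/
abbrev Sec (X : Superspace m M) (U : Opens M) : Type u := X.sheaf.presheaf.obj (op U)

/-- Restriction of superfunctions to a smaller open set. -/
def res (X : Superspace m M) {U V : Opens M} (h : U ≤ V) : X.Sec V →ₐ[ℝ] X.Sec U :=
  (X.sheaf.presheaf.map (homOfLE h).op).hom

/-- Restriction of smooth functions to a smaller open set. -/
abbrev resFun {U V : Opens M} (h : U ≤ V) : C^∞⟮𝓡 m, V; ℝ⟯ →+* C^∞⟮𝓡 m, U; ℝ⟯ :=
  ContMDiffMap.restrictRingHom (𝓡 m) 𝓘(ℝ, ℝ) ℝ h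

/-- The sections over `V` of the exterior algebra bundle of the trivial bundle of rank `k`: the
exterior algebra over `C^∞(V)` of the free module `C^∞(V)^k`. -/
abbrev FreeExterior (m k : ℕ) {M : Type u} [TopologicalSpace M]
    [ChartedSpace (EuclideanSpace ℝ (Fin m)) M] (V : Opens M) : Type u :=
  ExteriorAlgebra C^∞⟮𝓡 m, V; ℝ⟯ (Fin k → C^∞⟮𝓡 m, V; ℝ⟯)

/-- A local trivialization over `U` of odd rank `k`: an isomorphism, compatible with restrictions,
parity and `ε`, of the exterior algebra sheaf of the trivial bundle of rank `k` over `U`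
with the structure sheaf.  (Compatibility is required on scalars and on generators
`ι g`, which generate the exterior algebra.) -/
structure LocalTrivialization (X : Superspace m M) (k : ℕ) (U : Opens M) where
  equiv : ∀ V : Opens M, V ≤ U → FreeExterior m k V ≃ₐ[ℝ] X.Sec V
  res_scalar : ∀ (V W : Opens M) (hV : V ≤ U) (hW : W ≤ V) (f : C^∞⟮𝓡 m, V; ℝ⟯),
    X.res hW (equiv V hV (algebraMap _ _ f)) =
      equiv W (hW.trans hV) (algebraMap _ _ (resFun hW f))
  res_ι : ∀ (V W : Opens M) (hV : V ≤ U) (hW : W ≤ V) (g : Fin k → C^∞⟮𝓡 m, V; ℝ⟯),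
    X.res hW (equiv V hV (ExteriorAlgebra.ι _ g)) =
      equiv W (hW.trans hV) (ExteriorAlgebra.ι _ fun j => resFun hW (g j))
  scalar_even : ∀ (V : Opens M) (hV : V ≤ U) (f : C^∞⟮𝓡 m, V; ℝ⟯),
    equiv V hV (algebraMap _ _ f) ∈ X.parity V 0
  ι_odd : ∀ (V : Opens M) (hV : V ≤ U) (g : Fin k → C^∞⟮𝓡 m, V; ℝ⟯),
    equiv V hV (ExteriorAlgebra.ι _ g) ∈ X.parity V 1
  body_equiv : ∀ (V : Opens M) (hV : V ≤ U) (a : FreeExterior m k V),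
    X.body V (equiv V hV a) = ExteriorAlgebra.algebraMapInv a

/-- `X` is a supermanifold of dimension `(m, k)` with underlying manifold `M`: the structure sheaf
is a sheaf of `ℤ/2`-graded commutative algebras, locally isomorphic, compatibly with `ε`, to the
exterior algebra sheaf of a vector bundle of rank `k`.  (With `𝒩` the nilpotent subsheaf, it follows
from the local trivializations that `𝒩/𝒩²` is locally free of rank `k`, and that `ker ε = 𝒩`.) -/
structure IsSupermanifold (X : Superspace m M) (k : ℕ) : Prop where
  one_mem : ∀ U, (1 : X.Sec U) ∈ X.parity U 0
  mul_mem : ∀ U (i j : ZMod 2) (f g : X.Sec U),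
    f ∈ X.parity U i → g ∈ X.parity U j → f * g ∈ X.parity U (i + j)
  isInternal : ∀ U, DirectSum.IsInternal (X.parity U)
  res_parity : ∀ (U V : Opens M) (h : U ≤ V) (i : ZMod 2) (f : X.Sec V),
    f ∈ X.parity V i → X.res h f ∈ X.parity U i
  even_comm : ∀ U (f g : X.Sec U), f ∈ X.parity U 0 → f * g = g * f
  odd_anticomm : ∀ U (f g : X.Sec U), f ∈ X.parity U 1 → g ∈ X.parity U 1 → f * g = -(g * f)
  locally_trivial : ∀ p : M, ∃ U : Opens M, p ∈ U ∧ Nonempty (LocalTrivialization X k U)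

end Superspace

/-- A morphism of superspaces `(N, B) → (M, A)`: a smooth map `base : N → M` with a morphism
of sheaves of graded algebras `A → base_* B` compatible with `ε`. -/
structure Superspace.Hom {n m : ℕ} {N : Type v} {M : Type u}
    [TopologicalSpace N] [ChartedSpace (EuclideanSpace ℝ (Fin n)) N]
    [TopologicalSpace M] [ChartedSpace (EuclideanSpace ℝ (Fin m)) M]
    (Y : Superspace n N) (X : Superspace m M) where
  base : C^∞⟮𝓡 n, N; 𝓡 m, M⟯
  pullback : ∀ U : Opens M,
    X.Sec U →ₐ[ℝ] Y.Sec (Opens.comap ⟨base, base.contMDiff.continuous⟩ U)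
  pullback_res : ∀ (U V : Opens M) (h : U ≤ V) (f : X.Sec V),
    pullback U (X.res h f) = Y.res (OrderHomClass.mono (Opens.comap _) h) (pullback V f)
  pullback_parity : ∀ (U : Opens M) (i : ZMod 2) (f : X.Sec U),
    f ∈ X.parity U i → pullback U f ∈ Y.parity _ i
  body_pullback : ∀ (U : Opens M) (f : X.Sec U)
    (y : (Opens.comap ⟨base, base.contMDiff.continuous⟩ U : Opens N)),
    Y.body _ (pullback U f) y = X.body U f ⟨base y, y.2⟩

namespace Superspace.Hom

variable {n m : ℕ} {N : Type v} {M : Type u}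
    [TopologicalSpace N] [ChartedSpace (EuclideanSpace ℝ (Fin n)) N]
    [TopologicalSpace M] [ChartedSpace (EuclideanSpace ℝ (Fin m)) M]
    {Y : Superspace n N} {X : Superspace m M}

/-- The preimage of an open set under the underlying map. -/
def preimage (φ : Hom Y X) (U : Opens M) : Opens N :=
  Opens.comap ⟨φ.base, φ.base.contMDiff.continuous⟩ U

/-- `φ` exhibits `Y`, of odd dimension `l`, as a sub-supermanifold of `X`, of odd dimension `k`:
the underlying map is a smooth embedding of manifolds and every germ of superfunction on `Y`
is the pullback of a germ of superfunction on `X`. -/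
structure IsSubSupermanifold (φ : Hom Y X) (l k : ℕ) : Prop where
  source : Y.IsSupermanifold l
  target : X.IsSupermanifold k
  isSmoothEmbedding : Manifold.IsSmoothEmbedding (𝓡 n) (𝓡 m) ∞ φ.base
  surjective_germs : ∀ (V : Opens N) (y : N), y ∈ V → ∀ b : Y.Sec V,
    ∃ (U : Opens M) (_ : φ.base y ∈ U) (a : X.Sec U) (W : Opens N) (_ : y ∈ W)
      (hV : W ≤ V) (hU : W ≤ φ.preimage U), Y.res hU (φ.pullback U a) = Y.res hV b

/-- `F_j = 0` (`j ∈ ι`) are the equations of `φ : Y → X` in the open set `U`: the points of `Y`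
lying in `U` are the common zeros of the `ε(F_j)`, and the ideal sheaf of `Y` (the superfunctions
on `X` that pull back to zero on `Y`) is generated over `U` by the `F_j`.  Meant for homogeneous
`F_j`, for which left and two-sided ideals agree. -/
structure IsGivenByEquations (φ : Hom Y X) (U : Opens M) {ι : Type*} (F : ι → X.Sec U) :
    Prop where
  points : ∀ p : U, (p : M) ∈ Set.range φ.base ↔ ∀ j, X.body U (F j) p = 0
  ideal : ∀ (V : Opens M) (hV : V ≤ U) (f : X.Sec V),
    φ.pullback V f = 0 ↔ ∀ p ∈ V, ∃ (W : Opens M) (hW : W ≤ V), p ∈ W ∧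
      X.res hW f ∈ Ideal.span (Set.range fun j => X.res (hW.trans hV) (F j))

end Superspace.Hom

end Abstract

/-! ### The tautological supermanifold: differential forms -/

section Tautological

variable {m : ℕ} {M : Type u} [TopologicalSpace M] [ChartedSpace (EuclideanSpace ℝ (Fin m)) M]

variable (m) in
/-- The fibre at `x` of the exterior algebra bundle `Λ T*M`. -/
abbrev Fibre (x : M) : Type :=
  ExteriorAlgebra ℝ (Module.Dual ℝ (TangentSpace (𝓡 m) x))

variable (m) in
/-- The differential at `x` of a real function. -/
def differential (g : M → ℝ) (x : M) : Module.Dual ℝ (TangentSpace (𝓡 m) x) :=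
  ((NormedSpace.fromTangentSpace (g x)).toContinuousLinearMap ∘L
    mfderiv (𝓡 m) 𝓘(ℝ, ℝ) g x).toLinearMap

variable (m) in
/-- Not necessarily smooth sections of `Λ T*M` over `U`. -/
abbrev RawForm (U : Opens M) : Type u := (x : U) → Fibre m (x : M)

variable (m) in
/-- The smooth functions on `W` and the differentials of smooth functions on `W`. -/
def generators (W : Opens M) : Set (RawForm m W) :=
  {s | ∃ g : M → ℝ, ContMDiffOn (𝓡 m) 𝓘(ℝ, ℝ) ∞ g W ∧
    ((s = fun x : W => algebraMap ℝ (Fibre m (x : M)) (g x)) ∨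
      s = fun x : W => ExteriorAlgebra.ι ℝ (differential m g (x : M)))}

/-- Restriction of sections of `Λ T*M`. -/
def rawRes {U V : Opens M} (h : U ≤ V) : RawForm m V →ₐ[ℝ] RawForm m U where
  toFun f x := f ⟨x, h x.2⟩
  map_one' := rfl
  map_mul' _ _ := rfl
  map_zero' := rfl
  map_add' _ _ := rfl
  commutes' _ := rfl

/-- A section of `Λ T*M` is smooth if locally it is a polynomial in smooth functions and
differentials of smooth functions, i.e. a sum of terms `g₀ dg₁ ∧ ⋯ ∧ dg_k`. -/
def IsSmoothForm (U : Opens M) (f : RawForm m U) : Prop :=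
  ∀ p ∈ U, ∃ (W : Opens M) (h : W ≤ U), p ∈ W ∧
    rawRes h f ∈ Algebra.adjoin ℝ (generators m W)

theorem rawRes_mem_adjoin {W W' : Opens M} (h : W' ≤ W) {f : RawForm m W}
    (hf : f ∈ Algebra.adjoin ℝ (generators m W)) :
    rawRes h f ∈ Algebra.adjoin ℝ (generators m W') := by
  have h1 : Algebra.adjoin ℝ (generators m W) ≤
      (Algebra.adjoin ℝ (generators m W')).comap (rawRes h) := by
    refine Algebra.adjoin_le ?_
    rintro s ⟨g, hg, hs⟩
    refine Algebra.subset_adjoin ⟨g, hg.mono h, ?_⟩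
    rcases hs with rfl | rfl
    · exact Or.inl rfl
    · exact Or.inr rfl
  exact h1 hf

theorem IsSmoothForm.combine {U : Opens M} {f g k : RawForm m U} (hf : IsSmoothForm U f)
    (hg : IsSmoothForm U g)
    (hk : ∀ (W : Opens M) (h : W ≤ U), rawRes h f ∈ Algebra.adjoin ℝ (generators m W) →
      rawRes h g ∈ Algebra.adjoin ℝ (generators m W) →
      rawRes h k ∈ Algebra.adjoin ℝ (generators m W)) : IsSmoothForm U k := by
  intro p hp
  obtain ⟨W₁, h₁, hp₁, hf₁⟩ := hf p hp
  obtain ⟨W₂, h₂, hp₂, hg₂⟩ := hg p hp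
  refine ⟨W₁ ⊓ W₂, inf_le_left.trans h₁, ⟨hp₁, hp₂⟩, hk _ _ ?_ ?_⟩
  · exact rawRes_mem_adjoin (inf_le_left : W₁ ⊓ W₂ ≤ W₁) hf₁
  · exact rawRes_mem_adjoin (inf_le_right : W₁ ⊓ W₂ ≤ W₂) hg₂

theorem isSmoothForm_of_mem_adjoin {U : Opens M} {f : RawForm m U}
    (hf : f ∈ Algebra.adjoin ℝ (generators m U)) : IsSmoothForm U f :=
  fun _ hp => ⟨U, le_rfl, hp, hf⟩

variable (m) in
/-- The algebra `Ω(U)` of smooth differential forms of all degrees on `U`, i.e. of smooth sections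
of `Λ T*M`, with the exterior product. -/
def forms (U : Opens M) : Subalgebra ℝ (RawForm m U) where
  carrier := {f | IsSmoothForm U f}
  mul_mem' hf hg := hf.combine hg fun _ _ h₁ h₂ => by
    rw [map_mul]; exact mul_mem h₁ h₂
  add_mem' hf hg := hf.combine hg fun _ _ h₁ h₂ => by
    rw [map_add]; exact add_mem h₁ h₂
  algebraMap_mem' c := isSmoothForm_of_mem_adjoin (Subalgebra.algebraMap_mem _ c)

theorem rawRes_mem_forms {U V : Opens M} (h : U ≤ V) {f : RawForm m V} (hf : f ∈ forms m V) :
    rawRes h f ∈ forms m U := by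
  intro p hp
  obtain ⟨W, hW, hpW, hfW⟩ := hf p (h hp)
  exact ⟨W ⊓ U, inf_le_right, ⟨hpW, hp⟩, rawRes_mem_adjoin (inf_le_left : W ⊓ U ≤ W) hfW⟩

/-- Restriction of differential forms. -/
def formsRes {U V : Opens M} (h : U ≤ V) : forms m V →ₐ[ℝ] forms m U :=
  ((rawRes h).comp (forms m V).val).codRestrict (forms m U) fun f => rawRes_mem_forms h f.2

variable (m M) in
/-- The presheaf of differential forms. -/
def formsPresheaf : TopCat.Presheaf (AlgCat.{u} ℝ) (TopCat.of M) where
  obj U := AlgCat.of ℝ (forms m (M := M) U.unop)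
  map h := AlgCat.ofHom (formsRes (leOfHom h.unop))
  map_id _ := rfl
  map_comp _ _ := rfl

theorem formsPresheaf_isSheaf : (formsPresheaf m M).IsSheaf := by
  rw [TopCat.Presheaf.isSheaf_iff_isSheaf_comp (CategoryTheory.forget (AlgCat.{u} ℝ))]
  apply TopCat.Presheaf.isSheaf_of_isSheafUniqueGluing_types
  intro ι U sf hsf
  let sf' : ∀ i, forms m (M := M) (U i) := sf
  have hcompat : ∀ (i j : ι) (x : M) (hi : x ∈ U i) (hj : x ∈ U j),
      (sf' i).1 ⟨x, hi⟩ = (sf' j).1 ⟨x, hj⟩ := by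
    intro i j x hi hj
    have h1 := hsf i j
    exact congrFun (congrArg (fun s : forms m (M := M) (U i ⊓ U j) => s.1) h1) ⟨x, hi, hj⟩
  have hex : ∀ x : (iSup U : Opens M), ∃ i, (x : M) ∈ U i := fun x => Opens.mem_iSup.1 x.2
  choose c hc using hex
  let g : RawForm m (iSup U : Opens M) := fun x => (sf' (c x)).1 ⟨x, hc x⟩
  have hg : ∀ i, rawRes (le_iSup U i) g = (sf' i).1 := fun i => by
    funext x
    exact hcompat _ _ _ _ _
  have hgs : g ∈ forms m (iSup U : Opens M) := by
    intro p hp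
    obtain ⟨i, hi⟩ := Opens.mem_iSup.1 hp
    obtain ⟨W, hW, hpW, hW'⟩ := (sf' i).2 p hi
    refine ⟨W, hW.trans (le_iSup U i), hpW, ?_⟩
    rw [← hg i] at hW'
    exact hW'
  refine ⟨(⟨g, hgs⟩ : forms m (iSup U : Opens M)), fun i => Subtype.ext (hg i), ?_⟩
  intro t ht
  let t' : forms m (iSup U : Opens M) := t
  refine Subtype.ext (a1 := t') ?_
  funext x
  obtain ⟨i, hi⟩ := Opens.mem_iSup.1 x.2
  have h2 : (sf' i).1 ⟨x, hi⟩ = t'.1 x :=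
    (congrFun (congrArg (fun s : forms m (M := M) (U i) => s.1) (ht i)) ⟨x, hi⟩).symm
  rw [← h2]
  exact hcompat _ _ _ _ _

/-- The value at a point of the degree zero part of a form. -/
def scalarPart {U : Opens M} (f : RawForm m U) (x : U) : ℝ := ExteriorAlgebra.algebraMapInv (f x)

theorem scalarPart_contMDiff {U : Opens M} (f : forms m U) :
    ContMDiff (𝓡 m) 𝓘(ℝ, ℝ) ∞ (scalarPart f.1) := by
  have key : ∀ (W : Opens M) (s : RawForm m W), s ∈ Algebra.adjoin ℝ (generators m W) →
      ContMDiff (𝓡 m) 𝓘(ℝ, ℝ) ∞ (scalarPart s) := by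
    intro W s hs
    induction hs using Algebra.adjoin_induction with
    | mem s hs =>
      obtain ⟨g, hg, rfl | rfl⟩ := hs
      · have h1 : scalarPart (fun x : W => algebraMap ℝ (Fibre m (x : M)) (g x)) =
            fun x : W => g x := by
          funext x
          exact ExteriorAlgebra.algebraMap_leftInverse _ _
        rw [h1]
        intro x
        exact contMDiffAt_subtype_iff.2 (hg.contMDiffAt (W.2.mem_nhds x.2))
      · have h1 : scalarPart (fun x : W => ExteriorAlgebra.ι ℝ (differential m g (x : M))) =
            fun _ : W => (0 : ℝ) := by
          funext x
          simp [scalarPart, ExteriorAlgebra.algebraMapInv]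
        rw [h1]
        exact contMDiff_const
    | algebraMap c =>
      have h1 : scalarPart (algebraMap ℝ (RawForm m W) c) = fun _ : W => c := by
        funext x
        exact ExteriorAlgebra.algebraMap_leftInverse _ _
      rw [h1]
      exact contMDiff_const
    | add s t _ _ hs ht =>
      have h1 : scalarPart (s + t) = fun x => scalarPart s x + scalarPart t x := by
        funext x
        exact map_add _ _ _
      rw [h1]
      exact hs.add ht
    | mul s t _ _ hs ht =>
      have h1 : scalarPart (s * t) = fun x => scalarPart s x * scalarPart t x := by
        funext x
        exact map_mul _ _ _
      rw [h1]
      exact hs.mul ht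
  intro x
  obtain ⟨W, hW, hxW, h⟩ := f.2 x x.2
  have h2 := key W _ h ⟨x, hxW⟩
  classical
  let F : M → ℝ := fun y => if hy : y ∈ U then scalarPart f.1 ⟨y, hy⟩ else 0
  have hF : ∀ (y : M) (hy : y ∈ U), F y = scalarPart f.1 ⟨y, hy⟩ := fun y hy => dif_pos hy
  have h3 : scalarPart (rawRes hW f.1) = fun y : W => F y := by
    funext y
    exact (hF y (hW y.2)).symm
  have h4 : scalarPart f.1 = fun y : U => F y := by
    funext y
    exact (hF y y.2).symm
  rw [h3] at h2
  rw [h4]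
  have h5 : ContMDiffAt (𝓡 m) 𝓘(ℝ, ℝ) ∞ F (x : M) :=
    contMDiffAt_subtype_iff (x := (⟨x, hxW⟩ : W)) |>.1 h2
  exact contMDiffAt_subtype_iff.2 h5

variable (m M) in
/-- The tautological supermanifold of `M`: its superfunctions are the differential forms on `M`. -/
def tautological : Superspace m M where
  sheaf := ⟨formsPresheaf m M, formsPresheaf_isSheaf⟩
  parity U i :=
    { carrier := {f : forms m U | ∀ x, f.1 x ∈ CliffordAlgebra.evenOdd 0 i}
      zero_mem' := fun _ => Submodule.zero_mem _
      add_mem' := fun hf hg x => Submodule.add_mem _ (hf x) (hg x)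
      smul_mem' := fun c _ hf x => Submodule.smul_mem _ c (hf x) }
  body U :=
    { toFun := fun f : forms m U => ⟨scalarPart f.1, scalarPart_contMDiff f⟩
      map_one' := by ext x; exact map_one (ExteriorAlgebra.algebraMapInv (R := ℝ)
          (M := Module.Dual ℝ (TangentSpace (𝓡 m) (x : M))))
      map_mul' := fun f g => by
        ext x
        exact map_mul (ExteriorAlgebra.algebraMapInv (R := ℝ)) (f.1 x) (g.1 x)
      map_zero' := by
        ext x
        exact map_zero (ExteriorAlgebra.algebraMapInv (R := ℝ)
          (M := Module.Dual ℝ (TangentSpace (𝓡 m) (x : M))))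
      map_add' := fun f g => by
        ext x
        exact map_add (ExteriorAlgebra.algebraMapInv (R := ℝ)) (f.1 x) (g.1 x)
      commutes' := fun c => by ext x; exact ExteriorAlgebra.algebraMap_leftInverse _ _ }
  body_naturality _ _ _ _ _ := rfl

/-- A smooth function on `U`, as a superfunction. -/
def ofFun (U : Opens M) (g : M → ℝ) (hg : ContMDiffOn (𝓡 m) 𝓘(ℝ, ℝ) ∞ g U) :
    (tautological m M).Sec U :=
  (⟨fun x => algebraMap ℝ (Fibre m (x : M)) (g x),
    isSmoothForm_of_mem_adjoin (Algebra.subset_adjoin ⟨g, hg, Or.inl rfl⟩)⟩ : forms m U)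

/-- The differential `dg` of a smooth function on `U`, as a superfunction. -/
def ofDiff (U : Opens M) (g : M → ℝ) (hg : ContMDiffOn (𝓡 m) 𝓘(ℝ, ℝ) ∞ g U) :
    (tautological m M).Sec U :=
  (⟨fun x => ExteriorAlgebra.ι ℝ (differential m g (x : M)),
    isSmoothForm_of_mem_adjoin (Algebra.subset_adjoin ⟨g, hg, Or.inr rfl⟩)⟩ : forms m U)

/-! ### Local coordinates -/

/-- The domain of a chart. -/
def patch (e : OpenPartialHomeomorph M (EuclideanSpace ℝ (Fin m))) : Opens M :=
  ⟨e.source, e.open_source⟩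

/-- The partial derivative `∂g/∂x^k` in the coordinates `x^k` given by the chart `e`. -/
def partialDeriv (e : OpenPartialHomeomorph M (EuclideanSpace ℝ (Fin m))) (g : M → ℝ)
    (k : Fin m) (x : M) : ℝ :=
  fderiv ℝ (g ∘ e.symm) (e x) (EuclideanSpace.single k 1)

theorem coord_smooth {e : OpenPartialHomeomorph M (EuclideanSpace ℝ (Fin m))}
    (he : e ∈ IsManifold.maximalAtlas (𝓡 m) ∞ M) (k : Fin m) :
    ContMDiffOn (𝓡 m) 𝓘(ℝ, ℝ) ∞ (fun x => e x k) (patch e) :=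
  (EuclideanSpace.proj (𝕜 := ℝ) k).contDiff.contMDiff.comp_contMDiffOn
    (contMDiffOn_of_mem_maximalAtlas he)

theorem partialDeriv_smooth {e : OpenPartialHomeomorph M (EuclideanSpace ℝ (Fin m))}
    (he : e ∈ IsManifold.maximalAtlas (𝓡 m) ∞ M) {g : M → ℝ}
    (hg : ContMDiffOn (𝓡 m) 𝓘(ℝ, ℝ) ∞ g (patch e)) (k : Fin m) :
    ContMDiffOn (𝓡 m) 𝓘(ℝ, ℝ) ∞ (partialDeriv e g k) (patch e) := by
  have h1 : ContDiffOn ℝ ∞ (g ∘ e.symm) e.target :=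
    contMDiffOn_iff_contDiffOn.1
      (hg.comp (contMDiffOn_symm_of_mem_maximalAtlas he) fun y hy => e.map_target hy)
  have h2 : ContDiffOn ℝ ∞
      (fun y => fderiv ℝ (g ∘ e.symm) y (EuclideanSpace.single k 1)) e.target :=
    (h1.fderiv_of_isOpen e.open_target (by simp)).clm_apply contDiffOn_const
  exact h2.contMDiffOn.comp (contMDiffOn_of_mem_maximalAtlas he) fun x hx => e.map_source hx

/-- The odd coordinate `θ^k = dx^k`. -/
def theta {e : OpenPartialHomeomorph M (EuclideanSpace ℝ (Fin m))}
    (he : e ∈ IsManifold.maximalAtlas (𝓡 m) ∞ M) (k : Fin m) : (tautological m M).Sec (patch e) :=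
  ofDiff (patch e) (fun x => e x k) (coord_smooth he k)

/-- The odd superfunction `(∂g/∂x^k) θ^k` (summed over `k`). -/
def fermionic {e : OpenPartialHomeomorph M (EuclideanSpace ℝ (Fin m))}
    (he : e ∈ IsManifold.maximalAtlas (𝓡 m) ∞ M) (g : M → ℝ)
    (hg : ContMDiffOn (𝓡 m) 𝓘(ℝ, ℝ) ∞ g (patch e)) : (tautological m M).Sec (patch e) :=
  ∑ k : Fin m, ofFun (patch e) (partialDeriv e g k) (partialDeriv_smooth he hg k) * theta he k

/-- The Jacobian matrix `(∂V_a/∂x^k)` at a point. -/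
def jacobian (e : OpenPartialHomeomorph M (EuclideanSpace ℝ (Fin m))) {r : ℕ}
    (V : Fin r → M → ℝ) (x : M) : Matrix (Fin r) (Fin m) ℝ :=
  Matrix.of fun a k => partialDeriv e (V a) k x

end Tautological

/-- `φ`, a morphism between the tautological supermanifolds of `N` and `M`, is the pullback of
differential forms along its underlying map. -/
def IsPullbackOfForms {n m : ℕ} {N : Type v} {M : Type u}
    [TopologicalSpace N] [ChartedSpace (EuclideanSpace ℝ (Fin n)) N]
    [TopologicalSpace M] [ChartedSpace (EuclideanSpace ℝ (Fin m)) M]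
    (φ : Superspace.Hom (tautological n N) (tautological m M)) : Prop :=
  ∀ (U : Opens M) (f : forms m U) (y : N) (hy : φ.base y ∈ U),
    (show forms n (φ.preimage U) from φ.pullback U f).1 ⟨y, hy⟩ =
      ExteriorAlgebra.map (mfderiv (𝓡 n) (𝓡 m) φ.base y).toLinearMap.dualMap
        (f.1 ⟨φ.base y, hy⟩)

end SuperGeom

end

noncomputable section

namespace SuperGeom

/-! ### Pullback of differential forms -/

section Pullback

variable {m n : ℕ} {M : Type u} [TopologicalSpace M] [ChartedSpace (EuclideanSpace ℝ (Fin m)) M]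
  {N : Type v} [TopologicalSpace N] [ChartedSpace (EuclideanSpace ℝ (Fin n)) N]

/-! Two facts carry the proof. Locally a form is a polynomial in functions `g` and differentials
`dg`, so an identity between algebra homomorphisms of forms need only be checked on these. And near
a point of `N` there is a smooth retraction `ρ` from an open set of `M` to `N`, with `ρ ∘ i = id`.

The graded axioms of a supermanifold hold fibre by fibre in the exterior algebra. In a chart the
products `dx^I` form a basis of every fibre, and a smooth form has smooth coefficients in it, so
forms are the exterior algebra of a free module of rank `m` over the smooth functions
(`exists_trivMap_eq`). Every germ of a form `b` on `N` is a pullback from `M`, because `b = i^*(ρ^*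
b)`.

For the equations, `W_a = dV_a` (`fermionic_eq_ofDiff`), so the `V_a` and the `W_a` pull back to
zero. For the converse near a point of `N`, Hadamard's lemma in a slice chart writes the `V_a` as a
matrix of smooth functions applied to the transverse coordinates. The rank condition makes this
matrix injective at the point, hence left invertible nearby, and the transverse coordinates are
smooth combinations of the `V_a`. Again by Hadamard, so is every function `g` vanishing on `N`: `g =
∑ c_a V_a` (`exists_retraction_and_division`), and by the Leibniz rule `dg` lies in the ideal of the
`V_a` and `dV_a`. Applied to `g - ρ^* i^* g`, this gives `f - ρ^* i^* f` in the ideal for every form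
`f` (`sub_formsPullback_mem`); if `i^* f = 0`, then `f` itself is in it. Away from `N` some `V_a` is
invertible and the ideal is everything. -/

theorem differential_congr {g g' : M → ℝ} {x : M} (h : g =ᶠ[nhds x] g') :
    differential m g x = differential m g' x := by
  unfold differential
  rw [h.mfderiv_eq]
  exact LinearMap.ext fun _ => rfl

theorem differential_apply (g : M → ℝ) (x : M) (w : TangentSpace (𝓡 m) x) :
    differential m g x w = mfderiv (𝓡 m) 𝓘(ℝ, ℝ) g x w := rfl

theorem differential_comp {g : N → ℝ} {h : M → N} {x : M}
    (hg : MDifferentiableAt (𝓡 n) 𝓘(ℝ, ℝ) g (h x)) (hh : MDifferentiableAt (𝓡 m) (𝓡 n) h x) :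
    differential m (g ∘ h) x =
      (mfderiv (𝓡 m) (𝓡 n) h x).toLinearMap.dualMap (differential n g (h x)) := by
  ext w
  rw [differential_apply, mfderiv_comp x hg hh]
  rfl

theorem differential_add {g g' : M → ℝ} {x : M} (hg : MDifferentiableAt (𝓡 m) 𝓘(ℝ, ℝ) g x)
    (hg' : MDifferentiableAt (𝓡 m) 𝓘(ℝ, ℝ) g' x) :
    differential m (fun y => g y + g' y) x = differential m g x + differential m g' x := by
  ext w
  have h1 := mfderiv_add hg hg'
  have h2 := congrArg (fun L => L w) h1
  exact h2

theorem differential_mul {g g' : M → ℝ} {x : M} (hg : MDifferentiableAt (𝓡 m) 𝓘(ℝ, ℝ) g x)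
    (hg' : MDifferentiableAt (𝓡 m) 𝓘(ℝ, ℝ) g' x) :
    differential m (fun y => g y * g' y) x =
      g x • differential m g' x + g' x • differential m g x := by
  ext w
  have h1 := (hg.hasMFDerivAt.mul hg'.hasMFDerivAt).mfderiv
  have h2 := congrArg (fun L => L w) h1
  exact h2

theorem differential_zero_fun (x : M) : differential m (fun _ : M => (0 : ℝ)) x = 0 := by
  ext w
  rw [differential_apply, mfderiv_const]
  rfl

theorem differential_sub {g g' : M → ℝ} {x : M} (hg : MDifferentiableAt (𝓡 m) 𝓘(ℝ, ℝ) g x)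
    (hg' : MDifferentiableAt (𝓡 m) 𝓘(ℝ, ℝ) g' x) :
    differential m (fun y => g y - g' y) x = differential m g x - differential m g' x := by
  ext w
  have h1 := (hg.hasMFDerivAt.sub hg'.hasMFDerivAt).mfderiv
  have h2 := congrArg (fun L => L w) h1
  exact h2

theorem mdifferentiableAt_of_contMDiffOn {g : M → ℝ} {W : Opens M}
    (hg : ContMDiffOn (𝓡 m) 𝓘(ℝ, ℝ) ∞ g W) {x : M} (hx : x ∈ W) :
    MDifferentiableAt (𝓡 m) 𝓘(ℝ, ℝ) g x :=
  (hg.contMDiffAt (W.2.mem_nhds hx)).mdifferentiableAt (by simp)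

theorem differential_sum {ι : Type*} (s : Finset ι) {g : ι → M → ℝ} {x : M}
    (hg : ∀ j ∈ s, MDifferentiableAt (𝓡 m) 𝓘(ℝ, ℝ) (g j) x) :
    differential m (fun y => ∑ j ∈ s, g j y) x = ∑ j ∈ s, differential m (g j) x := by
  classical
  suffices h : MDifferentiableAt (𝓡 m) 𝓘(ℝ, ℝ) (fun y => ∑ j ∈ s, g j y) x ∧
      differential m (fun y => ∑ j ∈ s, g j y) x = ∑ j ∈ s, differential m (g j) x from h.2
  induction s using Finset.induction_on with
  | empty =>
    simp only [Finset.sum_empty]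
    exact ⟨mdifferentiableAt_const, differential_zero_fun x⟩
  | insert a s ha ih =>
    simp only [Finset.sum_insert ha]
    obtain ⟨h1, h2⟩ := ih fun j hj => hg j (Finset.mem_insert_of_mem hj)
    have h3 := hg a (Finset.mem_insert_self a s)
    exact ⟨h3.add h1, by rw [differential_add h3 h1, h2]⟩

/-- The pullback of not necessarily smooth differential forms along `h`. -/
def rawPullback (h : M → N) {W : Opens M} {V : Opens N} (hWV : ∀ x ∈ W, h x ∈ V) :
    RawForm n V →ₐ[ℝ] RawForm m W where
  toFun f x := ExteriorAlgebra.map (mfderiv (𝓡 m) (𝓡 n) h (x : M)).toLinearMap.dualMap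
    (f ⟨h x, hWV x x.2⟩)
  map_one' := funext fun _ => map_one _
  map_mul' _ _ := funext fun _ => map_mul _ _ _
  map_zero' := funext fun _ => map_zero _
  map_add' _ _ := funext fun _ => map_add _ _ _
  commutes' c := funext fun _ => AlgHom.commutes _ c

theorem rawPullback_fun {h : M → N} {W : Opens M} {V : Opens N} (hWV : ∀ x ∈ W, h x ∈ V)
    (g : N → ℝ) :
    rawPullback h hWV (fun x : V => algebraMap ℝ (Fibre n (x : N)) (g x)) =
      fun x : W => algebraMap ℝ (Fibre m (x : M)) ((g ∘ h) x) :=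
  funext fun _ => AlgHom.commutes _ _

theorem rawPullback_diff {h : M → N} {W : Opens M} {V : Opens N} (hWV : ∀ x ∈ W, h x ∈ V)
    (hh : ContMDiffOn (𝓡 m) (𝓡 n) ∞ h W)
    {g : N → ℝ} (hg : ContMDiffOn (𝓡 n) 𝓘(ℝ, ℝ) ∞ g V) :
    rawPullback h hWV (fun x : V => ExteriorAlgebra.ι ℝ (differential n g (x : N))) =
      fun x : W => ExteriorAlgebra.ι ℝ (differential m (g ∘ h) (x : M)) := by
  funext x
  rw [differential_comp (mdifferentiableAt_of_contMDiffOn hg (hWV x x.2))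
    ((hh.contMDiffAt (W.2.mem_nhds x.2)).mdifferentiableAt (by simp))]
  exact ExteriorAlgebra.map_apply_ι _ _

theorem rawPullback_mem_adjoin {h : M → N} {W : Opens M} {V : Opens N} (hWV : ∀ x ∈ W, h x ∈ V)
    (hh : ContMDiffOn (𝓡 m) (𝓡 n) ∞ h W) {f : RawForm n V}
    (hf : f ∈ Algebra.adjoin ℝ (generators n V)) :
    rawPullback h hWV f ∈ Algebra.adjoin ℝ (generators m W) := by
  have h1 : Algebra.adjoin ℝ (generators n V) ≤
      (Algebra.adjoin ℝ (generators m W)).comap (rawPullback h hWV) := by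
    refine Algebra.adjoin_le ?_
    rintro s ⟨g, hg, hs⟩
    refine Algebra.subset_adjoin ⟨g ∘ h, hg.comp hh hWV, ?_⟩
    rcases hs with rfl | rfl
    · exact Or.inl (rawPullback_fun hWV g)
    · exact Or.inr (rawPullback_diff hWV hh hg)
  exact h1 hf

theorem rawPullback_mem_forms {h : M → N} {W : Opens M} {V : Opens N} (hWV : ∀ x ∈ W, h x ∈ V)
    (hh : ContMDiffOn (𝓡 m) (𝓡 n) ∞ h W) {f : RawForm n V} (hf : f ∈ forms n V) :
    rawPullback h hWV f ∈ forms m W := by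
  intro p hp
  obtain ⟨V', hV', hpV, hfV⟩ := hf (h p) (hWV p hp)
  obtain ⟨W', hW', hWo, hpW'⟩ := mem_nhds_iff.1
    ((hh.continuousOn.continuousAt (W.2.mem_nhds hp)).preimage_mem_nhds (V'.2.mem_nhds hpV))
  let W'' : Opens M := ⟨W', hWo⟩ ⊓ W
  have hW'' : ∀ x ∈ W'', h x ∈ V' := fun x hx => hW' hx.1
  exact ⟨W'', inf_le_right, ⟨hpW', hp⟩,
    rawPullback_mem_adjoin hW'' (hh.mono (fun _ hx => hx.2)) hfV⟩

/-- The pullback of differential forms along a smooth map. -/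
def formsPullback {h : M → N} {W : Opens M} {V : Opens N} (hWV : ∀ x ∈ W, h x ∈ V)
    (hh : ContMDiffOn (𝓡 m) (𝓡 n) ∞ h W) : forms n V →ₐ[ℝ] forms m W :=
  ((rawPullback h hWV).comp (forms n V).val).codRestrict (forms m W)
    fun f => rawPullback_mem_forms hWV hh f.2

/-- Each vector goes to a vector, so word length is preserved. The induction starts from words of
length 0 or 1 and multiplies by two vectors at a time. -/
theorem map_mem_evenOdd {E F : Type*} [AddCommGroup E] [Module ℝ E] [AddCommGroup F] [Module ℝ F]
    (L : E →ₗ[ℝ] F) (i : ZMod 2) {a : ExteriorAlgebra ℝ E}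
    (ha : a ∈ CliffordAlgebra.evenOdd (0 : QuadraticForm ℝ E) i) :
    ExteriorAlgebra.map L a ∈ CliffordAlgebra.evenOdd (0 : QuadraticForm ℝ F) i := by
  refine CliffordAlgebra.evenOdd_induction 0 i (motive := fun a _ => ExteriorAlgebra.map L a ∈
    CliffordAlgebra.evenOdd (0 : QuadraticForm ℝ F) i) ?_ ?_ ?_ a ha
  · intro a h
    -- `evenOdd i` is the supremum of the powers of the space of vectors over all exponents
    -- congruent to `i`; the base case lives in the least such exponent.
    refine Submodule.mem_iSup_of_mem ⟨(i : ZMod 2).val, by simp⟩ ?_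
    have h2 : ExteriorAlgebra.map L a ∈
        ((LinearMap.range (CliffordAlgebra.ι (0 : QuadraticForm ℝ E))) ^ (i : ZMod 2).val).map
          (ExteriorAlgebra.map L).toLinearMap := ⟨a, h, rfl⟩
    rw [Submodule.map_pow] at h2
    have h3 : (LinearMap.range (CliffordAlgebra.ι (0 : QuadraticForm ℝ E))).map
        (ExteriorAlgebra.map L).toLinearMap ≤
        LinearMap.range (CliffordAlgebra.ι (0 : QuadraticForm ℝ F)) := by
      rintro _ ⟨_, ⟨w, rfl⟩, rfl⟩
      exact ⟨L w, (ExteriorAlgebra.map_apply_ι L w).symm⟩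
    exact pow_le_pow_left' h3 _ h2
  · intro x y _ _ hx hy
    rw [map_add]
    exact Submodule.add_mem _ hx hy
  · intro a b x _ hx
    rw [map_mul, map_mul]
    have h1 : ∀ w : E, ExteriorAlgebra.map L (CliffordAlgebra.ι (0 : QuadraticForm ℝ E) w) =
      CliffordAlgebra.ι (0 : QuadraticForm ℝ F) (L w) := fun w => ExteriorAlgebra.map_apply_ι L w
    rw [h1, h1, ← zero_add i]
    exact SetLike.mul_mem_graded (CliffordAlgebra.ι_mul_ι_mem_evenOdd_zero _ _ _) hx

/-- The morphism of tautological superspaces given by the pullback of differential forms. -/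
def pullbackHom (i : N → M) (hi : ContMDiff (𝓡 n) (𝓡 m) ∞ i) :
    Superspace.Hom (tautological n N) (tautological m M) where
  base := ⟨i, hi⟩
  pullback U := formsPullback (V := U)
    (W := Opens.comap ⟨i, hi.continuous⟩ U) (fun _ hx => hx) hi.contMDiffOn
  pullback_res _ _ _ _ := rfl
  pullback_parity U j f hf x := map_mem_evenOdd _ _ (hf ⟨i x, x.2⟩)
  body_pullback U f y := by
    let f' : forms m U := f
    -- Both sides are algebra homomorphisms that kill every covector, so they agree.
    have h1 : (ExteriorAlgebra.algebraMapInv (R := ℝ)).comp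
        (ExteriorAlgebra.map (mfderiv (𝓡 n) (𝓡 m) i (y : N)).toLinearMap.dualMap) =
        ExteriorAlgebra.algebraMapInv (R := ℝ) := by
      ext w
      simp [ExteriorAlgebra.algebraMapInv]
    exact congrArg (fun F => F (f'.1 ⟨i y, y.2⟩)) h1

theorem isPullbackOfForms_pullbackHom (i : N → M) (hi : ContMDiff (𝓡 n) (𝓡 m) ∞ i) :
    IsPullbackOfForms (pullbackHom i hi) := fun _ _ _ _ => rfl

end Pullback

end SuperGeom

/-! ### Graded commutativity of the exterior algebra -/

section GradedCommutative

open CliffordAlgebra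

variable {R E : Type*} [CommRing R] [AddCommGroup E] [Module R E]

/-- Moving a vector past `a` costs one sign per factor, which is the effect of the grading
involution. Both commutation laws below follow from this one. -/
theorem ExteriorAlgebra.ι_mul_eq_involute_mul_ι (w : E) (a : ExteriorAlgebra R E) :
    ExteriorAlgebra.ι R w * a = involute a * ExteriorAlgebra.ι R w := by
  induction a using ExteriorAlgebra.induction with
  | algebraMap r =>
    rw [AlgHom.commutes]
    exact (Algebra.commutes r _).symm
  | ι v =>
    have h1 : involute (ExteriorAlgebra.ι R v) = -ExteriorAlgebra.ι R v := involute_ι v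
    rw [h1, neg_mul, eq_neg_iff_add_eq_zero]
    exact ExteriorAlgebra.ι_add_mul_swap w v
  | mul a b ha hb => rw [map_mul, ← mul_assoc, ha, mul_assoc, hb, mul_assoc]
  | add a b ha hb => rw [map_add, mul_add, add_mul, ha, hb]

theorem ExteriorAlgebra.commute_of_even {a : ExteriorAlgebra R E}
    (ha : a ∈ evenOdd (0 : QuadraticForm R E) 0) (b : ExteriorAlgebra R E) : a * b = b * a := by
  induction b using ExteriorAlgebra.induction with
  | algebraMap r => exact (Algebra.commutes r _).symm
  | ι v =>
    rw [ExteriorAlgebra.ι_mul_eq_involute_mul_ι, involute_eq_of_mem_even ha]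
  | mul b c hb hc => rw [← mul_assoc, hb, mul_assoc, hc, mul_assoc]
  | add b c hb hc => rw [mul_add, add_mul, hb, hc]

theorem ExteriorAlgebra.anticommute_of_odd {a b : ExteriorAlgebra R E}
    (ha : a ∈ evenOdd (0 : QuadraticForm R E) 1) (hb : b ∈ evenOdd (0 : QuadraticForm R E) 1) :
    a * b = -(b * a) := by
  refine CliffordAlgebra.odd_induction 0
    (P := fun b _ => (a * b : ExteriorAlgebra R E) = -(b * a)) ?_ ?_ ?_ b hb
  · intro v
    have h1 := ExteriorAlgebra.ι_mul_eq_involute_mul_ι v a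
    rw [involute_eq_of_mem_odd ha, neg_mul] at h1
    exact eq_neg_of_add_eq_zero_right (by rw [← eq_neg_iff_add_eq_zero]; exact h1)
  · intro x y _ _ hx hy
    rw [mul_add, add_mul, hx, hy, neg_add]
  · intro v w x _ hx
    have h1 := ExteriorAlgebra.commute_of_even
      (ι_mul_ι_mem_evenOdd_zero (0 : QuadraticForm R E) v w) a
    rw [← mul_assoc, ← h1, mul_assoc, hx, mul_neg, ← mul_assoc]

end GradedCommutative

namespace SuperGeom

/-! ### Decomposition of forms into even and odd parts -/

section Parity

open CliffordAlgebra

variable {m : ℕ} {M : Type u} [TopologicalSpace M] [ChartedSpace (EuclideanSpace ℝ (Fin m)) M]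

/-- The grading involution on sections of `Λ T*M`. -/
def rawInvolute (U : Opens M) : RawForm m U →ₐ[ℝ] RawForm m U where
  toFun f x := involute (f x)
  map_one' := funext fun _ => map_one _
  map_mul' _ _ := funext fun _ => map_mul _ _ _
  map_zero' := funext fun _ => map_zero _
  map_add' _ _ := funext fun _ => map_add _ _ _
  commutes' c := funext fun _ => AlgHom.commutes _ c

/-- The involution fixes functions and negates differentials. Through it the even and odd parts of a
smooth form, being half the sum and half the difference with the involuted form, are themselves
smooth. -/
theorem rawInvolute_mem_adjoin {W : Opens M} {f : RawForm m W}
    (hf : f ∈ Algebra.adjoin ℝ (generators m W)) :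
    rawInvolute W f ∈ Algebra.adjoin ℝ (generators m W) := by
  have h1 : Algebra.adjoin ℝ (generators m W) ≤
      (Algebra.adjoin ℝ (generators m W)).comap (rawInvolute W) := by
    refine Algebra.adjoin_le ?_
    rintro s ⟨g, hg, rfl | rfl⟩
    · exact Algebra.subset_adjoin ⟨g, hg, Or.inl (funext fun x => AlgHom.commutes _ _)⟩
    · have h2 : rawInvolute W (fun x : W => ExteriorAlgebra.ι ℝ (differential m g (x : M))) =
          -fun x : W => ExteriorAlgebra.ι ℝ (differential m g (x : M)) :=
        funext fun x => involute_ι _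
      rw [Subalgebra.coe_comap, Set.mem_preimage, h2]
      exact neg_mem (Algebra.subset_adjoin ⟨g, hg, Or.inr rfl⟩)
  exact h1 hf

theorem rawInvolute_mem_forms {U : Opens M} {f : RawForm m U} (hf : f ∈ forms m U) :
    rawInvolute U f ∈ forms m U := fun p hp =>
  let ⟨W, hW, hpW, h⟩ := hf p hp
  ⟨W, hW, hpW, rawInvolute_mem_adjoin h⟩

theorem half_add_involute_mem_even {E : Type*} [AddCommGroup E] [Module ℝ E]
    (a : ExteriorAlgebra ℝ E) :
    (2⁻¹ : ℝ) • (a + involute a) ∈ evenOdd (0 : QuadraticForm ℝ E) 0 ∧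
      (2⁻¹ : ℝ) • (a - involute a) ∈ evenOdd (0 : QuadraticForm ℝ E) 1 := by
  have h1 : a ∈ evenOdd (0 : QuadraticForm ℝ E) 0 ⊔ evenOdd (0 : QuadraticForm ℝ E) 1 := by
    rw [(evenOdd_isCompl (0 : QuadraticForm ℝ E)).sup_eq_top]
    trivial
  obtain ⟨x, hx, y, hy, rfl⟩ := Submodule.mem_sup.1 h1
  have h2 : involute (x + y) = x - y := by
    rw [map_add, involute_eq_of_mem_even hx, involute_eq_of_mem_odd hy, sub_eq_add_neg]
  constructor
  · have h3 : (2⁻¹ : ℝ) • (x + y + involute (x + y)) = x := by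
      rw [h2]
      module
    exact h3.symm ▸ hx
  · have h3 : (2⁻¹ : ℝ) • (x + y - involute (x + y)) = y := by
      rw [h2]
      module
    exact h3.symm ▸ hy

theorem isInternal_parity (U : Opens M) :
    DirectSum.IsInternal ((tautological m M).parity U) := by
  rw [DirectSum.isInternal_submodule_iff_isCompl _ (i := 0) (j := 1) (by decide)
    (Set.eq_univ_of_forall fun i => by fin_cases i; exacts [Or.inl rfl, Or.inr rfl]).symm]
  constructor
  · rw [Submodule.disjoint_def]
    intro f h0 h1
    let f' : forms m U := f
    refine Subtype.ext (a1 := f') (a2 := 0) (funext fun x => ?_)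
    exact (Submodule.disjoint_def.1 (evenOdd_isCompl (0 : QuadraticForm ℝ _)).disjoint)
      _ (h0 x) (h1 x)
  · rw [codisjoint_iff, eq_top_iff]
    intro f _
    let f' : forms m U := f
    let g : forms m U := ⟨rawInvolute U f'.1, rawInvolute_mem_forms f'.2⟩
    let a : forms m U := (2⁻¹ : ℝ) • (f' + g)
    let b : forms m U := (2⁻¹ : ℝ) • (f' - g)
    refine Submodule.mem_sup.2 ⟨a, fun x => (half_add_involute_mem_even (f'.1 x)).1,
      b, fun x => (half_add_involute_mem_even (f'.1 x)).2, ?_⟩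
    change a + b = f'
    simp only [a, b]
    module

end Parity

end SuperGeom

namespace SuperGeom

/-! ### The coframe `dx^k` of a chart -/

section Coordinates

variable {m : ℕ} {M : Type u} [TopologicalSpace M] [ChartedSpace (EuclideanSpace ℝ (Fin m)) M]

theorem mdifferentiable_of_mem_maximalAtlas [IsManifold (𝓡 m) ∞ M]
    {e : OpenPartialHomeomorph M (EuclideanSpace ℝ (Fin m))}
    (he : e ∈ IsManifold.maximalAtlas (𝓡 m) ∞ M) : e.MDifferentiable (𝓡 m) (𝓡 m) :=
  ⟨(contMDiffOn_of_mem_maximalAtlas he).mdifferentiableOn (by simp),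
    (contMDiffOn_symm_of_mem_maximalAtlas he).mdifferentiableOn (by simp)⟩

variable [IsManifold (𝓡 m) ∞ M] {e : OpenPartialHomeomorph M (EuclideanSpace ℝ (Fin m))}

/-- The basis `dx^k` of the cotangent space. -/
def coordBasis (he : e ∈ IsManifold.maximalAtlas (𝓡 m) ∞ M)
    {x : M} (hx : x ∈ e.source) :
    Module.Basis (Fin m) ℝ (Module.Dual ℝ (TangentSpace (𝓡 m) x)) :=
  (EuclideanSpace.basisFun (Fin m) ℝ).toBasis.dualBasis.map
    ((mdifferentiable_of_mem_maximalAtlas he).mfderiv hx).toLinearEquiv.dualMap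

theorem differential_coord_apply (he : e ∈ IsManifold.maximalAtlas (𝓡 m) ∞ M)
    {x : M} (hx : x ∈ e.source) (k : Fin m)
    (w : TangentSpace (𝓡 m) x) :
    differential m (fun y => e y k) x w =
      (show EuclideanSpace ℝ (Fin m) from mfderiv (𝓡 m) (𝓡 m) e x w) k := by
  have h1 : MDifferentiableAt (𝓡 m) (𝓡 m) e x :=
    (mdifferentiable_of_mem_maximalAtlas he).mdifferentiableAt hx
  have h2 := (EuclideanSpace.proj (𝕜 := ℝ) k : EuclideanSpace ℝ (Fin m) →L[ℝ] ℝ).hasMFDerivAt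
    (x := e x)
  rw [differential_apply]
  have h3 := (h2.comp x h1.hasMFDerivAt).mfderiv
  exact congrArg (fun L => L w) h3

theorem coordBasis_apply (he : e ∈ IsManifold.maximalAtlas (𝓡 m) ∞ M)
    {x : M} (hx : x ∈ e.source) (k : Fin m) :
    coordBasis he hx k = differential m (fun y => e y k) x := by
  ext w
  rw [differential_coord_apply he hx]
  have h1 : ∀ v, (EuclideanSpace.basisFun (Fin m) ℝ).toBasis.dualBasis k v = v k :=
    fun v => by simp
  exact h1 _

/-- Chain rule for `g = (g ∘ e.symm) ∘ e` near `x`, with the image of a tangent vector expanded in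
the standard basis. -/
theorem differential_eq_sum (he : e ∈ IsManifold.maximalAtlas (𝓡 m) ∞ M)
    {x : M} (hx : x ∈ e.source) {g : M → ℝ}
    (hg : MDifferentiableAt (𝓡 m) 𝓘(ℝ, ℝ) g x) :
    differential m g x =
      ∑ k, partialDeriv e g k x • differential m (fun y => e y k) x := by
  have hE := mdifferentiable_of_mem_maximalAtlas he
  have h1 : MDifferentiableAt (𝓡 m) (𝓡 m) e x := hE.mdifferentiableAt hx
  have h2 : MDifferentiableAt (𝓡 m) 𝓘(ℝ, ℝ) (g ∘ e.symm) (e x) := by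
    refine MDifferentiableAt.comp (I' := 𝓡 m) (e x) ?_ (hE.mdifferentiableAt_symm (e.map_source hx))
    rwa [e.left_inv hx]
  have h3 : g =ᶠ[nhds x] (g ∘ e.symm) ∘ e := by
    filter_upwards [e.open_source.mem_nhds hx] with y hy
    simp [e.left_inv hy]
  ext w
  let D : EuclideanSpace ℝ (Fin m) := mfderiv (𝓡 m) (𝓡 m) e x w
  have h4 : differential m g x w = fderiv ℝ (g ∘ e.symm) (e x) D := by
    rw [differential_congr h3, differential_apply, mfderiv_comp x h2 h1, mfderiv_eq_fderiv]
    rfl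
  rw [h4, LinearMap.sum_apply]
  have h5 : D = ∑ k, D k • EuclideanSpace.single k (1 : ℝ) := by
    have h6 := ((EuclideanSpace.basisFun (Fin m) ℝ).sum_repr D).symm
    simpa using h6
  conv_lhs => rw [h5]
  rw [map_sum]
  refine Finset.sum_congr rfl fun k _ => ?_
  rw [LinearMap.smul_apply, differential_coord_apply he hx, map_smul, smul_eq_mul, smul_eq_mul,
    mul_comm]
  rfl

end Coordinates

/-! ### Local trivialization of the sheaf of forms -/

section Trivialization

variable {m : ℕ} {M : Type u} [TopologicalSpace M] [ChartedSpace (EuclideanSpace ℝ (Fin m)) M]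

open Superspace

/-- Sections of `Λ T*M` form an algebra over the smooth functions. -/
instance rawFormAlgebra (V : Opens M) : Algebra C^∞⟮𝓡 m, V; ℝ⟯ (RawForm m V) :=
  RingHom.toAlgebra'
    { toFun := fun c x => algebraMap ℝ (Fibre m (x : M)) (c x)
      map_one' := funext fun _ => map_one _
      map_mul' := fun _ _ => funext fun _ => map_mul _ _ _
      map_zero' := funext fun _ => map_zero _
      map_add' := fun _ _ => funext fun _ => map_add _ _ _ }
    fun c f => funext fun x => Algebra.commutes (c x) (f x)

theorem algebraMap_rawForm_apply {V : Opens M} (c : C^∞⟮𝓡 m, V; ℝ⟯) (x : V) :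
    algebraMap C^∞⟮𝓡 m, V; ℝ⟯ (RawForm m V) c x = algebraMap ℝ (Fibre m (x : M)) (c x) := rfl

theorem smul_rawForm_apply {V : Opens M} (c : C^∞⟮𝓡 m, V; ℝ⟯) (f : RawForm m V) (x : V) :
    (c • f) x = c x • f x := by
  rw [Algebra.smul_def, Algebra.smul_def]
  rfl

instance rawForm_isScalarTower (V : Opens M) :
    IsScalarTower ℝ C^∞⟮𝓡 m, V; ℝ⟯ (RawForm m V) :=
  IsScalarTower.of_algebraMap_eq fun _ => rfl

open Classical in
/-- Extension by zero of a function on an open subset. -/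
def extendFun {V : Opens M} (c : V → ℝ) (y : M) : ℝ := if hy : y ∈ V then c ⟨y, hy⟩ else 0

theorem extendFun_apply {V : Opens M} (c : V → ℝ) (y : V) : extendFun c y = c y := dif_pos y.2

/-- The generators of smooth forms are functions on all of `M` required to be smooth only on the
open set, so extension by zero turns a section into a generator without any cutoff. -/
theorem extendFun_contMDiffOn {V : Opens M} {c : V → ℝ} (hc : ContMDiff (𝓡 m) 𝓘(ℝ, ℝ) ∞ c) :
    ContMDiffOn (𝓡 m) 𝓘(ℝ, ℝ) ∞ (extendFun c) V := by
  intro x hx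
  have h1 : (fun y : V => extendFun c y) = c := funext (extendFun_apply c)
  have h2 : ContMDiffAt (𝓡 m) 𝓘(ℝ, ℝ) ∞ (fun y : V => extendFun c y) ⟨x, hx⟩ := by
    rw [h1]
    exact hc _
  exact (contMDiffAt_subtype_iff.1 h2).contMDiffWithinAt

theorem contMDiff_of_locally {V : Opens M} {c : V → ℝ}
    (h : ∀ x : V, ∃ (W : Opens M) (hW : W ≤ V), (x : M) ∈ W ∧
      ContMDiff (𝓡 m) 𝓘(ℝ, ℝ) ∞ fun y : W => c ⟨y, hW y.2⟩) :
    ContMDiff (𝓡 m) 𝓘(ℝ, ℝ) ∞ c := by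
  intro x
  obtain ⟨W, hW, hxW, h1⟩ := h x
  have h2 : (fun y : W => c ⟨y, hW y.2⟩) = fun y : W => extendFun c y :=
    funext fun y => (extendFun_apply c ⟨y, hW y.2⟩).symm
  rw [h2] at h1
  have h3 : ContMDiffAt (𝓡 m) 𝓘(ℝ, ℝ) ∞ (extendFun c) (x : M) :=
    contMDiffAt_subtype_iff (x := (⟨x, hxW⟩ : W)) |>.1 (h1 _)
  have h4 : c = fun y : V => extendFun c y := funext fun y => (extendFun_apply c y).symm
  rw [h4]
  exact contMDiffAt_subtype_iff.2 h3

/-- The restriction of a smooth function on `M ⊇ V` to `V`. -/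
def smoothRestrict {V : Opens M} {g : M → ℝ} (hg : ContMDiffOn (𝓡 m) 𝓘(ℝ, ℝ) ∞ g V) :
    C^∞⟮𝓡 m, V; ℝ⟯ :=
  ⟨fun x => g x, fun x => contMDiffAt_subtype_iff.2 (hg.contMDiffAt (V.2.mem_nhds x.2))⟩

section Fixed

variable {e : OpenPartialHomeomorph M (EuclideanSpace ℝ (Fin m))}

/-- The one-form `∑ g_k dx^k`. -/
def coordForm (e : OpenPartialHomeomorph M (EuclideanSpace ℝ (Fin m))) (V : Opens M) :
    (Fin m → C^∞⟮𝓡 m, V; ℝ⟯) →ₗ[C^∞⟮𝓡 m, V; ℝ⟯] RawForm m V where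
  toFun g x := ExteriorAlgebra.ι ℝ (∑ k, g k x • differential m (fun y => e y k) (x : M))
  map_add' g g' := by
    funext x
    refine Eq.trans ?_ (map_add (ExteriorAlgebra.ι ℝ) _ _)
    rw [← Finset.sum_add_distrib]
    refine congrArg _ (Finset.sum_congr rfl fun k _ => ?_)
    exact add_smul _ _ _
  map_smul' c g := by
    funext x
    refine Eq.trans ?_ (smul_rawForm_apply c _ x).symm
    refine Eq.trans ?_ (map_smul (ExteriorAlgebra.ι ℝ) (c x) _)
    rw [Finset.smul_sum]
    refine congrArg _ (Finset.sum_congr rfl fun k _ => ?_)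
    exact mul_smul _ _ _

/-- The homomorphism from the exterior algebra of the free module sending the `k`-th basis vector
to `dx^k`. -/
def trivMap (e : OpenPartialHomeomorph M (EuclideanSpace ℝ (Fin m))) (V : Opens M) :
    FreeExterior m m V →ₐ[C^∞⟮𝓡 m, V; ℝ⟯] RawForm m V :=
  ExteriorAlgebra.lift _ ⟨coordForm e V, fun _ => funext fun _ => ExteriorAlgebra.ι_sq_zero _⟩

theorem trivMap_ι (V : Opens M) (g : Fin m → C^∞⟮𝓡 m, V; ℝ⟯) :
    trivMap e V (ExteriorAlgebra.ι _ g) = coordForm e V g :=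
  ExteriorAlgebra.lift_ι_apply _ _ _ _

theorem coordForm_single (V : Opens M) (k : Fin m) (x : V) :
    coordForm e V (Pi.single k 1) x =
      ExteriorAlgebra.ι ℝ (differential m (fun y => e y k) (x : M)) := by
  refine congrArg (ExteriorAlgebra.ι ℝ) ?_
  rw [Finset.sum_eq_single k]
  · rw [Pi.single_eq_same]
    exact one_smul _ _
  · intro j _ hj
    rw [Pi.single_eq_of_ne hj]
    exact zero_smul _ _
  · simp

variable (m) in
/-- The basis of the exterior algebra of the free module. -/
def freeBasis (V : Opens M) : Module.Basis (Finset (Fin m)) C^∞⟮𝓡 m, V; ℝ⟯ (FreeExterior m m V) :=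
  (Pi.basisFun C^∞⟮𝓡 m, V; ℝ⟯ (Fin m)).ExteriorAlgebra

theorem trivMap_mem_adjoin (he : e ∈ IsManifold.maximalAtlas (𝓡 m) ∞ M)
    {V : Opens M} (hV : V ≤ patch e) (a : FreeExterior m m V) :
    trivMap e V a ∈ Algebra.adjoin ℝ (generators m V) := by
  have hfun : ∀ c : C^∞⟮𝓡 m, V; ℝ⟯,
      algebraMap C^∞⟮𝓡 m, V; ℝ⟯ (RawForm m V) c ∈ Algebra.adjoin ℝ (generators m V) := by
    intro c
    refine Algebra.subset_adjoin ⟨extendFun c, extendFun_contMDiffOn c.contMDiff,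
      Or.inl (funext fun x => ?_)⟩
    rw [extendFun_apply]
    rfl
  induction a using ExteriorAlgebra.induction with
  | algebraMap c =>
    rw [AlgHom.commutes]
    exact hfun c
  | ι g =>
    have h1 : coordForm e V g = ∑ k, algebraMap C^∞⟮𝓡 m, V; ℝ⟯ (RawForm m V) (g k) *
        fun x : V => ExteriorAlgebra.ι ℝ (differential m (fun y => e y k) (x : M)) := by
      funext x
      rw [Finset.sum_apply]
      refine (map_sum (ExteriorAlgebra.ι ℝ) _ _).trans (Finset.sum_congr rfl fun k _ => ?_)
      rw [map_smul, Algebra.smul_def]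
      rfl
    rw [trivMap_ι, h1]
    exact sum_mem fun k _ => mul_mem (hfun _) (Algebra.subset_adjoin
      ⟨fun y => e y k, (coord_smooth he k).mono hV, Or.inr rfl⟩)
  | mul a b ha hb =>
    rw [map_mul]
    exact mul_mem ha hb
  | add a b ha hb =>
    rw [map_add]
    exact add_mem ha hb

variable [IsManifold (𝓡 m) ∞ M]

/-- The basis `dx^I` of the exterior algebra of the cotangent space. -/
def fibreBasis (he : e ∈ IsManifold.maximalAtlas (𝓡 m) ∞ M)
    {x : M} (hx : x ∈ e.source) : Module.Basis (Finset (Fin m)) ℝ (Fibre m x) :=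
  (coordBasis he hx).ExteriorAlgebra

/-- Basis monomials go to basis monomials in each fibre. Hence the coefficients of `a` can be read
off pointwise from `trivMap e V a`, which yields both injectivity and smoothness of coefficients. -/
theorem trivMap_freeBasis (he : e ∈ IsManifold.maximalAtlas (𝓡 m) ∞ M)
    {V : Opens M} (hV : V ≤ patch e) (s : Finset (Fin m)) (x : V) :
    trivMap e V (freeBasis m V s) x = fibreBasis he (hV x.2) s := by
  have h1 : fibreBasis he (hV x.2) s = _ :=
    (ExteriorAlgebra.basis_apply _ _).trans (ExteriorAlgebra.ιMulti_apply _)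
  have h2 : freeBasis m V s = _ :=
    (ExteriorAlgebra.basis_apply _ _).trans (ExteriorAlgebra.ιMulti_apply _)
  rw [h1, h2, map_list_prod, List.map_ofFn]
  refine (map_list_prod (Pi.evalRingHom (fun x : V => Fibre m (x : M)) x) _).trans ?_
  rw [List.map_ofFn]
  refine congrArg List.prod (congrArg List.ofFn (funext fun j => ?_))
  have h3 : ∀ k, trivMap e V (ExteriorAlgebra.ι _ (Pi.basisFun C^∞⟮𝓡 m, V; ℝ⟯ (Fin m) k)) x =
      ExteriorAlgebra.ι ℝ (coordBasis he (hV x.2) k) := by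
    intro k
    rw [trivMap_ι, Pi.basisFun_apply, coordForm_single]
    exact congrArg _ (coordBasis_apply he (hV x.2) k).symm
  exact h3 _

theorem trivMap_apply (he : e ∈ IsManifold.maximalAtlas (𝓡 m) ∞ M)
    {V : Opens M} (hV : V ≤ patch e) (a : FreeExterior m m V) (x : V) :
    trivMap e V a x = ∑ s, (freeBasis m V).repr a s x • fibreBasis he (hV x.2) s := by
  conv_lhs => rw [← (freeBasis m V).sum_repr a, map_sum]
  rw [Finset.sum_apply]
  refine Finset.sum_congr rfl fun s _ => ?_
  rw [map_smul, smul_rawForm_apply, trivMap_freeBasis he hV]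

theorem repr_trivMap (he : e ∈ IsManifold.maximalAtlas (𝓡 m) ∞ M)
    {V : Opens M} (hV : V ≤ patch e) (a : FreeExterior m m V) (x : V)
    (s : Finset (Fin m)) :
    (fibreBasis he (hV x.2)).repr (trivMap e V a x) s = (freeBasis m V).repr a s x := by
  rw [trivMap_apply he hV, Module.Basis.repr_sum_self]

theorem trivMap_injective (he : e ∈ IsManifold.maximalAtlas (𝓡 m) ∞ M)
    {V : Opens M} (hV : V ≤ patch e) :
    Function.Injective (trivMap e V) := by
  intro a b hab
  refine (freeBasis m V).repr.injective (Finsupp.ext fun s => ?_)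
  ext x
  rw [← repr_trivMap he hV, ← repr_trivMap he hV, hab]

theorem adjoin_le_range_trivMap (he : e ∈ IsManifold.maximalAtlas (𝓡 m) ∞ M)
    {V : Opens M} (hV : V ≤ patch e) :
    Algebra.adjoin ℝ (generators m V) ≤ ((trivMap e V).restrictScalars ℝ).range := by
  refine Algebra.adjoin_le ?_
  rintro _ ⟨g, hg, rfl | rfl⟩
  · exact ⟨algebraMap _ _ (smoothRestrict hg), AlgHom.commutes _ _⟩
  · have h1 : ∀ k, ContMDiffOn (𝓡 m) 𝓘(ℝ, ℝ) ∞ (partialDeriv e g k) V := by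
      intro k
      -- Here `g` is smooth on `V` only, so `partialDeriv_smooth`, which needs the whole chart
      -- domain, does not apply.
      have hV1 : ContDiffOn ℝ ∞ (g ∘ e.symm) (e.target ∩ e.symm ⁻¹' V) :=
        contMDiffOn_iff_contDiffOn.1 (hg.comp ((contMDiffOn_symm_of_mem_maximalAtlas he).mono
          Set.inter_subset_left) fun y hy => hy.2)
      have h2 : ContDiffOn ℝ ∞ (fun y => fderiv ℝ (g ∘ e.symm) y (EuclideanSpace.single k 1))
          (e.target ∩ e.symm ⁻¹' V) :=
        (hV1.fderiv_of_isOpen (e.isOpen_inter_preimage_symm V.2) (by simp)).clm_apply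
          contDiffOn_const
      refine h2.contMDiffOn.comp ((contMDiffOn_of_mem_maximalAtlas he).mono hV) fun x hx => ?_
      refine ⟨e.map_source (hV hx), ?_⟩
      rw [Set.mem_preimage, e.left_inv (hV hx)]
      exact hx
    refine ⟨ExteriorAlgebra.ι _ fun k => smoothRestrict (h1 k), ?_⟩
    refine (trivMap_ι V _).trans (funext fun x => ?_)
    rw [differential_eq_sum he (hV x.2) (mdifferentiableAt_of_contMDiffOn hg x.2)]
    rfl

/-- A smooth form is a polynomial in generators only locally, so preimages must be glued. The
coefficients in the basis `dx^I` are determined pointwise on all of `V`, and the local preimages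
show that they are smooth. -/
theorem exists_trivMap_eq (he : e ∈ IsManifold.maximalAtlas (𝓡 m) ∞ M)
    {V : Opens M} (hV : V ≤ patch e) {f : RawForm m V}
    (hf : f ∈ forms m V) : ∃ a, trivMap e V a = f := by
  have h1 : ∀ s, ContMDiff (𝓡 m) 𝓘(ℝ, ℝ) ∞
      fun x : V => (fibreBasis he (hV x.2)).repr (f x) s := by
    intro s
    refine contMDiff_of_locally fun x => ?_
    obtain ⟨W, hW, hxW, hfW⟩ := hf x x.2
    obtain ⟨a, ha⟩ := adjoin_le_range_trivMap he (hW.trans hV) hfW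
    refine ⟨W, hW, hxW, ?_⟩
    have h2 : (fun y : W => (fibreBasis he (hV (hW y.2))).repr (f ⟨y, hW y.2⟩) s) =
        (freeBasis m W).repr a s := by
      funext y
      rw [← repr_trivMap he (hW.trans hV)]
      exact congrArg (fun z => (fibreBasis he (hV (hW y.2))).repr z s) (congrFun ha y).symm
    rw [h2]
    exact ContMDiffMap.contMDiff _
  let c : Finset (Fin m) → C^∞⟮𝓡 m, V; ℝ⟯ := fun s => ⟨_, h1 s⟩
  refine ⟨∑ s, c s • freeBasis m V s, funext fun x => ?_⟩
  rw [trivMap_apply he hV]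
  conv_rhs => rw [← (fibreBasis he (hV x.2)).sum_repr (f x)]
  refine Finset.sum_congr rfl fun s _ => ?_
  rw [Module.Basis.repr_sum_self]
  rfl

/-- The trivialization of the algebra of differential forms given by coordinates. -/
def trivEquiv (he : e ∈ IsManifold.maximalAtlas (𝓡 m) ∞ M)
    {V : Opens M} (hV : V ≤ patch e) : FreeExterior m m V ≃ₐ[ℝ] forms m V :=
  AlgEquiv.ofBijective (((trivMap e V).restrictScalars ℝ).codRestrict (forms m V)
    fun a => isSmoothForm_of_mem_adjoin (trivMap_mem_adjoin he hV a))
    ⟨fun _ _ h => trivMap_injective he hV (congrArg Subtype.val h), fun f =>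
      let ⟨a, ha⟩ := exists_trivMap_eq he hV f.2
      ⟨a, Subtype.ext ha⟩⟩

theorem trivEquiv_val (he : e ∈ IsManifold.maximalAtlas (𝓡 m) ∞ M)
    {V : Opens M} (hV : V ≤ patch e) (a : FreeExterior m m V) :
    (trivEquiv he hV a).1 = trivMap e V a := rfl

/-- Local coordinates trivialize the tautological supermanifold. -/
def localTrivialization (he : e ∈ IsManifold.maximalAtlas (𝓡 m) ∞ M) : LocalTrivialization (tautological m M) m (patch e) where
  equiv _ hV := trivEquiv he hV
  res_scalar V W hV hW f := by
    refine Subtype.ext (a1 := formsRes hW (trivEquiv he hV (algebraMap _ _ f)))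
      (a2 := trivEquiv he (hW.trans hV) (algebraMap _ _ (resFun hW f))) ?_
    rw [trivEquiv_val, AlgHom.commutes]
    refine (congrArg (rawRes hW) ((trivEquiv_val he hV _).trans (AlgHom.commutes _ f))).trans ?_
    rfl
  res_ι V W hV hW g := by
    refine Subtype.ext (a1 := formsRes hW (trivEquiv he hV (ExteriorAlgebra.ι _ g)))
      (a2 := trivEquiv he (hW.trans hV) (ExteriorAlgebra.ι _ fun j => resFun hW (g j))) ?_
    rw [trivEquiv_val, trivMap_ι]
    refine (congrArg (rawRes hW) ((trivEquiv_val he hV _).trans (trivMap_ι _ g))).trans ?_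
    rfl
  scalar_even V hV f x := by
    have h1 : (trivEquiv he hV (algebraMap _ _ f)).1 x = algebraMap ℝ (Fibre m (x : M)) (f x) :=
      congrFun ((trivEquiv_val he hV _).trans (AlgHom.commutes _ f)) x
    exact Set.mem_of_eq_of_mem h1 (SetLike.algebraMap_mem_graded (CliffordAlgebra.evenOdd 0) _)
  ι_odd V hV g x := by
    have h1 : (trivEquiv he hV (ExteriorAlgebra.ι _ g)).1 x = coordForm e V g x :=
      congrFun ((trivEquiv_val he hV _).trans (trivMap_ι _ g)) x
    exact Set.mem_of_eq_of_mem h1 (CliffordAlgebra.ι_mem_evenOdd_one _ _)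
  body_equiv V hV a := by
    have h1 : ∀ (a : FreeExterior m m V) (x : V),
        ExteriorAlgebra.algebraMapInv (trivMap e V a x) = ExteriorAlgebra.algebraMapInv a x := by
      intro a x
      induction a using ExteriorAlgebra.induction with
      | algebraMap c =>
        rw [AlgHom.commutes, algebraMap_rawForm_apply, ExteriorAlgebra.algebraMap_leftInverse,
          ExteriorAlgebra.algebraMap_leftInverse]
      | ι g =>
        rw [trivMap_ι]
        have h2 : ExteriorAlgebra.algebraMapInv
          (ExteriorAlgebra.ι C^∞⟮𝓡 m, V; ℝ⟯ g) = 0 := by simp [ExteriorAlgebra.algebraMapInv]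
        rw [h2]
        simp [ExteriorAlgebra.algebraMapInv, coordForm]
      | mul a b ha hb =>
        rw [map_mul, map_mul, Pi.mul_apply, map_mul, ha, hb]
        rfl
      | add a b ha hb =>
        rw [map_add, map_add, Pi.add_apply, map_add, ha, hb]
        rfl
    ext x
    exact h1 a x

end Fixed

variable (m M) in
theorem isSupermanifold_tautological [IsManifold (𝓡 m) ∞ M] :
    (tautological m M).IsSupermanifold m where
  one_mem U x := SetLike.one_mem_graded (CliffordAlgebra.evenOdd 0)
  mul_mem U i j f g hf hg x := SetLike.mul_mem_graded (A := CliffordAlgebra.evenOdd 0) (hf x) (hg x)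
  isInternal := isInternal_parity
  res_parity U V h i f hf x := hf ⟨x, h x.2⟩
  even_comm U f g hf := by
    let f' : forms m U := f
    let g' : forms m U := g
    exact Subtype.ext (a1 := f' * g') (a2 := g' * f')
      (funext fun x => ExteriorAlgebra.commute_of_even (hf x) _)
  odd_anticomm U f g hf hg := by
    let f' : forms m U := f
    let g' : forms m U := g
    exact Subtype.ext (a1 := f' * g') (a2 := -(g' * f'))
      (funext fun x => ExteriorAlgebra.anticommute_of_odd (hf x) (hg x))
  locally_trivial p := ⟨patch (chartAt _ p), mem_chart_source _ p,
    ⟨localTrivialization (IsManifold.chart_mem_maximalAtlas p)⟩⟩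

end Trivialization

end SuperGeom

/-! ### Parametric integrals and Hadamard's lemma -/

section Hadamard

open MeasureTheory Set intervalIntegral

variable {E F : Type u} [NormedAddCommGroup E] [NormedAddCommGroup F] [NormedSpace ℝ F]

theorem continuousOn_parametric_integral {W : Set E} {G : E × ℝ → F}
    (hG : ContinuousOn G (W ×ˢ Icc (0 : ℝ) 1)) :
    ContinuousOn (fun x => ∫ t in (0 : ℝ)..1, G (x, t)) W := by
  rw [continuousOn_iff_continuous_domRestrict]
  -- Clamping `t` to `[0, 1]` makes the integrand continuous for all real `t` without changing the
  -- integral.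
  let p : ℝ → Icc (0 : ℝ) 1 := projIcc 0 1 zero_le_one
  have h1 : Continuous (Function.uncurry fun (x : W) (t : ℝ) => G (x, p t)) := by
    refine hG.comp_continuous (f := fun z : W × ℝ => ((z.1 : E), (p z.2 : ℝ))) ?_ fun z =>
      ⟨z.1.2, (p z.2).2⟩
    exact (continuous_subtype_val.comp continuous_fst).prodMk
      (continuous_subtype_val.comp (continuous_projIcc.comp continuous_snd))
  have h2 := continuous_parametric_intervalIntegral_of_continuous' (μ := volume) h1 0 1
  convert h2 using 2 with x
  refine integral_congr fun t ht => ?_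
  rw [uIcc_of_le zero_le_one] at ht
  simp only [p, projIcc_of_mem zero_le_one ht]

variable [NormedSpace ℝ E] [FiniteDimensional ℝ E]

theorem hasFDerivAt_parametric_integral {W : Set E} (hW : IsOpen W) {Ω : Set (E × ℝ)}
    (hΩ : IsOpen Ω) (hWΩ : W ×ˢ Icc (0 : ℝ) 1 ⊆ Ω) {G : E × ℝ → F} (hG : ContDiffOn ℝ 1 G Ω)
    {x : E} (hx : x ∈ W) :
    HasFDerivAt (fun x => ∫ t in (0 : ℝ)..1, G (x, t))
      (∫ t in (0 : ℝ)..1, (fderiv ℝ G (x, t)).comp (ContinuousLinearMap.inl ℝ E ℝ)) x := by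
  have hG' : ContinuousOn (fun z => (fderiv ℝ G z).comp (ContinuousLinearMap.inl ℝ E ℝ)) Ω :=
    (hG.continuousOn_fderiv_of_isOpen hΩ le_rfl).clm_comp continuousOn_const
  have hIoc : uIoc (0 : ℝ) 1 ⊆ Icc 0 1 := by
    rw [uIoc_of_le zero_le_one]
    exact Ioc_subset_Icc_self
  have hslice : ∀ {F' : Type u} [NormedAddCommGroup F'] {f : E × ℝ → F'}, ContinuousOn f Ω →
      ∀ y ∈ W, ContinuousOn (fun t => f (y, t)) (Icc 0 1) := fun hf y hy =>
    hf.comp (by fun_prop) fun t ht => hWΩ ⟨hy, ht⟩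
  -- The constant dominating the derivative comes from compactness of closed ball times `[0, 1]`.
  obtain ⟨r, hr, hrW⟩ := Metric.nhds_basis_closedBall.mem_iff.1 (hW.mem_nhds hx)
  obtain ⟨C, hC⟩ := ((isCompact_closedBall x r).prod (isCompact_Icc (a := (0 : ℝ)) (b := 1)))
    |>.exists_bound_of_continuousOn (hG'.mono fun z hz => hWΩ ⟨hrW hz.1, hz.2⟩)
  refine hasFDerivAt_integral_of_dominated_of_fderiv_le (𝕜 := ℝ) (μ := volume)
    (F := fun x t => G (x, t))
    (F' := fun x t => (fderiv ℝ G (x, t)).comp (ContinuousLinearMap.inl ℝ E ℝ))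
    (bound := fun _ => C) (Metric.closedBall_mem_nhds x hr) ?_ ?_ ?_ ?_ ?_ ?_
  · filter_upwards [hW.mem_nhds hx] with y hy
    exact ((hslice hG.continuousOn y hy).aestronglyMeasurable measurableSet_Icc).mono_measure
      (Measure.restrict_mono hIoc le_rfl)
  · refine ContinuousOn.intervalIntegrable ?_
    rw [uIcc_of_le zero_le_one]
    exact hslice hG.continuousOn x hx
  · exact ((hslice hG' x hx).aestronglyMeasurable measurableSet_Icc).mono_measure
      (Measure.restrict_mono hIoc le_rfl)
  · exact Filter.Eventually.of_forall fun t ht y hy => hC (y, t) ⟨hy, hIoc ht⟩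
  · exact intervalIntegrable_const
  · refine Filter.Eventually.of_forall fun t ht y hy => ?_
    have h1 : HasFDerivAt G (fderiv ℝ G (y, t)) (y, t) :=
      ((hG.contDiffAt (hΩ.mem_nhds (hWΩ ⟨hrW hy, hIoc ht⟩))).differentiableAt
        (by simp)).hasFDerivAt
    exact h1.comp y (hasFDerivAt_prodMk_left y t)

theorem contDiffOn_parametric_integral {W : Set E} (hW : IsOpen W) {Ω : Set (E × ℝ)}
    (hΩ : IsOpen Ω) (hWΩ : W ×ˢ Icc (0 : ℝ) 1 ⊆ Ω) {G : E × ℝ → F} (hG : ContDiffOn ℝ ∞ G Ω) :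
    ContDiffOn ℝ ∞ (fun x => ∫ t in (0 : ℝ)..1, G (x, t)) W := by
  rw [contDiffOn_infty]
  intro k
  -- The derivative is again a parametric integral, now with values in `E →L[ℝ] F`; hence the target
  -- varies in the induction.
  induction k generalizing F with
  | zero =>
    exact contDiffOn_zero.2 (continuousOn_parametric_integral (hG.continuousOn.mono hWΩ))
  | succ k ih =>
    have h1 := fun x (hx : x ∈ W) =>
      hasFDerivAt_parametric_integral hW hΩ hWΩ (hG.of_le (by simp)) hx
    push_cast
    rw [contDiffOn_succ_iff_fderiv_of_isOpen hW]
    refine ⟨fun x hx => (h1 x hx).differentiableAt.differentiableWithinAt, by simp, ?_⟩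
    refine (ih (G := fun z => (fderiv ℝ G z).comp (ContinuousLinearMap.inl ℝ E ℝ)) ?_).congr
      fun x hx => (h1 x hx).fderiv
    exact (hG.fderiv_of_isOpen hΩ (by simp)).clm_comp contDiffOn_const

/-- **Hadamard's lemma** for functions on a ball in a product. -/
theorem exists_contDiffOn_sub_eq {E₁ E₂ : Type u} [NormedAddCommGroup E₁] [NormedSpace ℝ E₁]
    [FiniteDimensional ℝ E₁] [NormedAddCommGroup E₂] [NormedSpace ℝ E₂] [FiniteDimensional ℝ E₂]
    [CompleteSpace F] {u₀ : E₁} {r : ℝ} {g : E₁ × E₂ → F}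
    (hg : ContDiffOn ℝ ∞ g (Metric.ball (u₀, 0) r)) :
    ∃ h : E₁ × E₂ → E₂ →L[ℝ] F, ContDiffOn ℝ ∞ h (Metric.ball (u₀, 0) r) ∧
      ∀ z ∈ Metric.ball (u₀, (0 : E₂)) r, g z - g (z.1, 0) = h z z.2 := by
  set B := Metric.ball (u₀, (0 : E₂)) r
  -- The witness is `h(z) = ∫₀¹ ∂₂g(z₁, t z₂) dt`, and the identity is the fundamental theorem of
  -- calculus along `t ↦ (z₁, t z₂)`.
  let q : (E₁ × E₂) × ℝ → E₁ × E₂ := fun w => (w.1.1, w.2 • w.1.2)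
  have hq : ContDiff ℝ ∞ q := by fun_prop
  have hΩ : IsOpen (q ⁻¹' B) := Metric.isOpen_ball.preimage hq.continuous
  -- In the sup metric the ball is a product of balls, so it is stable under shrinking the second
  -- coordinate alone.
  have hB : B ×ˢ Icc (0 : ℝ) 1 ⊆ q ⁻¹' B := by
    rintro ⟨z, t⟩ ⟨hz, ht⟩
    simp only [B, ← ball_prod_same, Set.mem_prod, mem_preimage, q, mem_ball_zero_iff] at hz ⊢
    refine ⟨hz.1, lt_of_le_of_lt ?_ hz.2⟩
    rw [norm_smul, Real.norm_of_nonneg ht.1]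
    exact mul_le_of_le_one_left (norm_nonneg _) ht.2
  let G : (E₁ × E₂) × ℝ → E₂ →L[ℝ] F := fun w =>
    (fderiv ℝ g (q w)).comp (ContinuousLinearMap.inr ℝ E₁ E₂)
  have hG : ContDiffOn ℝ ∞ G (q ⁻¹' B) :=
    ((hg.fderiv_of_isOpen Metric.isOpen_ball (by simp)).comp hq.contDiffOn
      fun _ hw => hw).clm_comp contDiffOn_const
  refine ⟨fun z => ∫ t in (0 : ℝ)..1, G (z, t),
    contDiffOn_parametric_integral Metric.isOpen_ball hΩ hB hG, fun z hz => ?_⟩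
  have hGt : ContinuousOn (fun t => G (z, t)) (uIcc 0 1) := by
    rw [uIcc_of_le zero_le_one]
    exact hG.continuousOn.comp (by fun_prop) fun t ht => hB ⟨hz, ht⟩
  rw [ContinuousLinearMap.intervalIntegral_apply hGt.intervalIntegrable]
  have h1 : ∀ t ∈ uIcc (0 : ℝ) 1,
      HasDerivAt (fun t : ℝ => g (z.1, t • z.2)) (G (z, t) z.2) t := by
    intro t ht
    rw [uIcc_of_le zero_le_one] at ht
    have h2 : HasFDerivAt g (fderiv ℝ g (q (z, t))) (z.1, t • z.2) :=
      ((hg.contDiffAt (Metric.isOpen_ball.mem_nhds (hB ⟨hz, ht⟩))).differentiableAt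
        (by simp)).hasFDerivAt
    have h3 : HasDerivAt (fun t : ℝ => (z.1, t • z.2)) (0, z.2) t := by
      have h4 := (hasDerivAt_id t).smul_const z.2
      rw [one_smul] at h4
      exact (hasDerivAt_const t z.1).prodMk h4
    exact h2.comp_hasDerivAt t h3
  rw [integral_eq_sub_of_hasDerivAt h1
    (hGt.clm_apply continuousOn_const).intervalIntegrable]
  simp

end Hadamard

namespace SuperGeom

/-! ### Slice charts and local retractions onto `N` -/

section Slice

open Metric

variable {m n : ℕ} {M : Type u} [TopologicalSpace M] [ChartedSpace (EuclideanSpace ℝ (Fin m)) M]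
  {N : Type v} [TopologicalSpace N] [ChartedSpace (EuclideanSpace ℝ (Fin n)) N]

/-- A chart of `M` in which the image of `i : N → M` is the slice `F = 0`, together with the
corresponding parametrization of `N`. -/
structure SliceChart (m n : ℕ) {M : Type u} [TopologicalSpace M]
    [ChartedSpace (EuclideanSpace ℝ (Fin m)) M] {N : Type v} [TopologicalSpace N]
    [ChartedSpace (EuclideanSpace ℝ (Fin n)) N] (i : N → M)
    (F : Type) [NormedAddCommGroup F] [NormedSpace ℝ F] where
  chart : OpenPartialHomeomorph M (EuclideanSpace ℝ (Fin n) × F)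
  smooth : ContMDiffOn (𝓡 m) 𝓘(ℝ, EuclideanSpace ℝ (Fin n) × F) ∞ chart chart.source
  smooth_symm : ContMDiffOn 𝓘(ℝ, EuclideanSpace ℝ (Fin n) × F) (𝓡 m) ∞ chart.symm chart.target
  param : EuclideanSpace ℝ (Fin n) → N
  param_smooth : ContMDiffOn (𝓡 n) (𝓡 n) ∞ param {u | (u, (0 : F)) ∈ chart.target}
  apply_param : ∀ u, (u, (0 : F)) ∈ chart.target → i (param u) = chart.symm (u, 0)
  exists_param : ∀ y, i y ∈ chart.source → ∃ u, chart (i y) = (u, 0) ∧ param u = y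

namespace SliceChart

variable {i : N → M} {F : Type} [NormedAddCommGroup F] [NormedSpace ℝ F]

/-- Restriction of a slice chart to an open subset of its target. -/
def restr (c : SliceChart m n i F) (O : Set (EuclideanSpace ℝ (Fin n) × F)) (hO : IsOpen O) :
    SliceChart m n i F where
  chart := (c.chart.symm.restrOpen O hO).symm
  smooth := c.smooth.mono fun _ hx => hx.1
  smooth_symm := c.smooth_symm.mono fun _ hx => hx.1
  param := c.param
  param_smooth := c.param_smooth.mono fun _ hu => hu.1
  apply_param u hu := c.apply_param u hu.1
  exists_param y hy := c.exists_param y hy.1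

theorem restr_target (c : SliceChart m n i F) {O : Set (EuclideanSpace ℝ (Fin n) × F)}
    (hO : IsOpen O) : (c.restr O hO).chart.target = c.chart.target ∩ O := rfl

/-- Around a point of the image of `i` there are arbitrarily small slice charts onto balls. -/
theorem exists_ball (c : SliceChart m n i F) {y : N} (hy : i y ∈ c.chart.source)
    {O : Set (EuclideanSpace ℝ (Fin n) × F)} (hO : O ∈ nhds (c.chart (i y))) :
    ∃ (c' : SliceChart m n i F) (u : EuclideanSpace ℝ (Fin n)) (r : ℝ),
      c'.chart.target = ball (u, 0) r ∧ c'.chart.target ⊆ c.chart.target ∩ O ∧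
      i y ∈ c'.chart.source ∧ c'.chart.source ⊆ c.chart.source ∧ c'.chart (i y) = (u, 0) ∧
      (∀ x, c'.chart x = c.chart x) ∧ ∀ z, c'.chart.symm z = c.chart.symm z := by
  obtain ⟨u, hu, -⟩ := c.exists_param y hy
  have h1 : c.chart.target ∩ O ∈ nhds (c.chart (i y)) :=
    Filter.inter_mem (c.chart.open_target.mem_nhds (c.chart.map_source hy)) hO
  rw [hu] at h1
  obtain ⟨r, hr, hrO⟩ := Metric.mem_nhds_iff.1 h1
  have h2 : (c.restr (ball (u, 0) r) isOpen_ball).chart.target = ball (u, 0) r := by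
    rw [restr_target]
    exact Set.inter_eq_right.2 fun z hz => (hrO hz).1
  refine ⟨c.restr (ball (u, 0) r) isOpen_ball, u, r, h2, ?_, ⟨hy, ?_⟩, fun _ hx => hx.1, hu,
    fun _ => rfl, fun _ => rfl⟩
  · rw [h2]
    exact hrO
  · change c.chart (i y) ∈ ball (u, 0) r
    rw [hu]
    exact mem_ball_self hr

/-- The retraction of a slice chart onto `N`. -/
def retraction (c : SliceChart m n i F) (x : M) : N := c.param (c.chart x).1

/-- The domain of a slice chart. -/
def domain (c : SliceChart m n i F) : Opens M := ⟨c.chart.source, c.chart.open_source⟩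

theorem retraction_apply (c : SliceChart m n i F) {y : N} (hy : i y ∈ c.domain) :
    c.retraction (i y) = y := by
  obtain ⟨u, hu, rfl⟩ := c.exists_param y hy
  rw [retraction, hu]

/-- This is the reason for shrinking to balls centred on the slice: the projection `(z₁, z₂) ↦ (z₁,
0)`, and with it the retraction, stays in the chart. -/
theorem fst_mem_target (c : SliceChart m n i F) {u : EuclideanSpace ℝ (Fin n)} {r : ℝ}
    (hc : c.chart.target = ball (u, 0) r) {z : EuclideanSpace ℝ (Fin n) × F}
    (hz : z ∈ c.chart.target) : (z.1, 0) ∈ c.chart.target := by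
  rw [hc, ← ball_prod_same, Set.mem_prod] at hz ⊢
  exact ⟨hz.1, mem_ball_self (dist_nonneg.trans_lt hz.1)⟩

theorem apply_retraction (c : SliceChart m n i F) {u : EuclideanSpace ℝ (Fin n)} {r : ℝ}
    (hc : c.chart.target = ball (u, 0) r) {x : M} (hx : x ∈ c.domain) :
    i (c.retraction x) ∈ c.domain := by
  have h1 := c.fst_mem_target hc (c.chart.map_source hx)
  rw [retraction, c.apply_param _ h1]
  exact c.chart.map_target h1

theorem retraction_smooth (c : SliceChart m n i F) {u : EuclideanSpace ℝ (Fin n)} {r : ℝ}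
    (hc : c.chart.target = ball (u, 0) r) :
    ContMDiffOn (𝓡 m) (𝓡 n) ∞ c.retraction c.domain := by
  have h1 : ContMDiffOn (𝓡 m) (𝓡 n) ∞ (fun x => (c.chart x).1) c.chart.source :=
    (ContinuousLinearMap.fst ℝ (EuclideanSpace ℝ (Fin n)) F).contDiff.contMDiff.comp_contMDiffOn
      c.smooth
  exact c.param_smooth.comp h1 fun x hx => c.fst_mem_target hc (c.chart.map_source hx)

end SliceChart

/-- The immersion property gives the normal form `u ↦ (u, 0)`; the embedding property excludes other
sheets of `N` from a small enough chart. -/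
theorem exists_sliceChart [IsManifold (𝓡 m) ∞ M] [IsManifold (𝓡 n) ∞ N] {i : N → M}
    (hi : Manifold.IsSmoothEmbedding (𝓡 n) (𝓡 m) ∞ i) (y : N) {O : Set M} (hO : O ∈ nhds (i y)) :
    ∃ (F : Type) (_ : NormedAddCommGroup F) (_ : NormedSpace ℝ F) (_ : FiniteDimensional ℝ F)
      (c : SliceChart m n i F), Module.finrank ℝ F + n = m ∧ i y ∈ c.chart.source ∧
        c.chart.source ⊆ O := by
  have him := hi.isImmersion.isImmersionAt y
  let h := him.isImmersionAtOfComplement_complement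
  -- Inside `O₁` the only points of `N` are those of the chart domain in `N`.
  obtain ⟨O₁, hO₁, hO₁'⟩ := hi.isEmbedding.isInducing.isOpen_iff.1 h.domChart.open_source
  obtain ⟨O₂, hO₂O, hO₂, hyO₂⟩ := _root_.mem_nhds_iff.1 hO
  have hfin : FiniteDimensional ℝ him.complement :=
    Module.Finite.of_injective
      (h.equiv.toLinearEquiv.toLinearMap ∘ₗ LinearMap.inr ℝ (EuclideanSpace ℝ (Fin n)) him.complement)
      (h.equiv.injective.comp LinearMap.inr_injective)
  have hrank : Module.finrank ℝ him.complement + n = m := by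
    have h1 := h.equiv.toLinearEquiv.finrank_eq
    rw [Module.finrank_prod, finrank_euclideanSpace_fin, finrank_euclideanSpace_fin] at h1
    omega
  let Φ : OpenPartialHomeomorph M (EuclideanSpace ℝ (Fin n) × him.complement) :=
    (h.codChart.transHomeomorph h.equiv.symm.toHomeomorph).restrOpen (O₁ ∩ O₂) (hO₁.inter hO₂)
  have hwrite : ∀ u ∈ h.domChart.target,
      h.codChart (i (h.domChart.symm u)) = h.equiv (u, 0) := by
    intro u hu
    have h0 : u ∈ (h.domChart.extend (𝓡 n)).target := by simpa using hu
    simpa using h.writtenInCharts h0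
  have hmem : ∀ y', i y' ∈ O₁ ↔ y' ∈ h.domChart.source := fun y' => by rw [← hO₁']; rfl
  have hval : ∀ y' ∈ h.domChart.source, Φ (i y') = (h.domChart y', 0) := by
    intro y' hy'
    have h1 := hwrite _ (h.domChart.map_source hy')
    rw [h.domChart.left_inv hy'] at h1
    exact h.equiv.symm_apply_eq.2 h1
  -- With the target cut down to this set, each of its points `(u, 0)` comes from a point of `N`.
  have hS : IsOpen {z : EuclideanSpace ℝ (Fin n) × him.complement | z.1 ∈ h.domChart.target} :=
    h.domChart.open_target.preimage continuous_fst
  have hsmooth := contMDiffOn_of_mem_maximalAtlas h.codChart_mem_maximalAtlas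
  have hsmooth' := contMDiffOn_symm_of_mem_maximalAtlas h.codChart_mem_maximalAtlas
  have hparam := contMDiffOn_symm_of_mem_maximalAtlas h.domChart_mem_maximalAtlas
  refine ⟨him.complement, inferInstance, inferInstance, hfin,
    { chart := (Φ.symm.restrOpen _ hS).symm
      smooth := ?_
      smooth_symm := ?_
      param := h.domChart.symm
      param_smooth := hparam.mono fun _ hu => hu.2
      apply_param := ?_
      exists_param := ?_ }, hrank, ⟨⟨h.mem_codChart_source, ?_, hyO₂⟩, ?_⟩,
    fun _ hx => hO₂O hx.1.2.2⟩
  · exact h.equiv.symm.contDiff.contMDiff.comp_contMDiffOn (hsmooth.mono fun _ hx => hx.1.1)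
  · exact hsmooth'.comp h.equiv.contDiff.contMDiff.contMDiffOn fun _ hz => hz.1.1
  · intro u hu
    have h1 := h.source_subset_preimage_source (h.domChart.map_target hu.2)
    change _ = h.codChart.symm (h.equiv (u, 0))
    rw [← hwrite u hu.2, h.codChart.left_inv h1]
  · intro y' hy'
    have h1 := (hmem y').1 hy'.1.2.1
    exact ⟨h.domChart y', hval y' h1, h.domChart.left_inv h1⟩
  · exact (hmem y).2 h.mem_domChart_source
  · change (Φ (i y)).1 ∈ h.domChart.target
    rw [hval y h.mem_domChart_source]
    exact h.domChart.map_source h.mem_domChart_source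

end Slice

end SuperGeom

/-! ### Division by the defining functions -/

namespace SuperGeom

theorem jacobian_rank_le {m : ℕ} {M : Type u} [TopologicalSpace M]
    {e : OpenPartialHomeomorph M (EuclideanSpace ℝ (Fin m))} {r : ℕ}
    {V : Fin r → M → ℝ} {x : M} {L : EuclideanSpace ℝ (Fin m) →L[ℝ] Fin r → ℝ}
    (hL : HasFDerivAt (fun w a => V a (e.symm w)) L (e x)) :
    (jacobian e V x).rank ≤ Module.finrank ℝ (LinearMap.range L.toLinearMap) := by
  rw [Matrix.rank_eq_finrank_span_cols]
  refine Submodule.finrank_mono (Submodule.span_le.2 ?_)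
  rintro _ ⟨k, rfl⟩
  refine ⟨EuclideanSpace.single k 1, funext fun a => ?_⟩
  have h1 : HasFDerivAt (V a ∘ e.symm) ((ContinuousLinearMap.proj a).comp L) (e x) :=
    hasFDerivAt_pi'.1 hL a
  change _ = fderiv ℝ (V a ∘ e.symm) (e x) (EuclideanSpace.single k 1)
  rw [h1.fderiv]
  rfl

section Division

open Metric

variable {m n : ℕ} {M : Type u} [TopologicalSpace M] [ChartedSpace (EuclideanSpace ℝ (Fin m)) M]
  {N : Type v} [TopologicalSpace N] [ChartedSpace (EuclideanSpace ℝ (Fin n)) N]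
  {i : N → M} {F : Type} [NormedAddCommGroup F] [NormedSpace ℝ F]

/-- Hadamard's lemma in a slice chart. -/
theorem SliceChart.exists_eq_apply_snd [FiniteDimensional ℝ F] (c : SliceChart m n i F)
    {u : EuclideanSpace ℝ (Fin n)} {r : ℝ} (hc : c.chart.target = ball (u, 0) r)
    {G : Type} [NormedAddCommGroup G] [NormedSpace ℝ G] [CompleteSpace G]
    {g : M → G} (hg : ContMDiffOn (𝓡 m) 𝓘(ℝ, G) ∞ g c.chart.source)
    (h0 : ∀ y, i y ∈ c.chart.source → g (i y) = 0) :
    ∃ H : EuclideanSpace ℝ (Fin n) × F → F →L[ℝ] G, ContDiffOn ℝ ∞ H (ball (u, 0) r) ∧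
      ∀ x ∈ c.chart.source, g x = H (c.chart x) (c.chart x).2 := by
  have h1 : ContDiffOn ℝ ∞ (g ∘ c.chart.symm) (ball (u, 0) r) := by
    rw [← hc]
    exact contMDiffOn_iff_contDiffOn.1 (hg.comp c.smooth_symm fun z hz => c.chart.map_target hz)
  obtain ⟨H, hH, h2⟩ := exists_contDiffOn_sub_eq h1
  refine ⟨H, hH, fun x hx => ?_⟩
  have h3 := c.chart.map_source hx
  have h4 := c.fst_mem_target hc h3
  have h5 : g (c.chart.symm ((c.chart x).1, 0)) = 0 := by
    rw [← c.apply_param _ h4]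
    refine h0 _ ?_
    rw [c.apply_param _ h4]
    exact c.chart.map_target h4
  have h6 := h2 _ (hc ▸ h3)
  rw [Function.comp_apply, Function.comp_apply, h5, sub_zero, c.chart.left_inv hx] at h6
  exact h6

/-- At a point of the slice, differentiating `V = H(z) z₂` leaves only `H(z) dz₂`, so the rank of
`H(z)` is at least that of the Jacobian, hence at least `dim F`. Rank-nullity then gives
injectivity. -/
theorem SliceChart.ker_eq_bot [IsManifold (𝓡 m) ∞ M] [FiniteDimensional ℝ F]
    (c : SliceChart m n i F) {e : OpenPartialHomeomorph M (EuclideanSpace ℝ (Fin m))}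
    (he : e ∈ IsManifold.maximalAtlas (𝓡 m) ∞ M) {r : ℕ} {V : Fin r → M → ℝ} {x : M}
    (hxe : x ∈ e.source) (hxc : x ∈ c.chart.source)
    {H : EuclideanSpace ℝ (Fin n) × F → F →L[ℝ] Fin r → ℝ}
    (hH : DifferentiableAt ℝ H (c.chart x)) (hx0 : (c.chart x).2 = 0)
    (hVH : ∀ y ∈ c.chart.source, (fun a => V a y) = H (c.chart y) (c.chart y).2)
    (hrank : Module.finrank ℝ F ≤ (jacobian e V x).rank) :
    LinearMap.ker (H (c.chart x)).toLinearMap = ⊥ := by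
  let A : EuclideanSpace ℝ (Fin m) → EuclideanSpace ℝ (Fin n) × F := fun w => c.chart (e.symm w)
  have hex := e.map_source hxe
  have hAx : A (e x) = c.chart x := by simp only [A, e.left_inv hxe]
  have hA : DifferentiableAt ℝ A (e x) := by
    have h1 : ContMDiffAt (𝓡 m) (𝓡 m) ∞ e.symm (e x) :=
      (contMDiffOn_symm_of_mem_maximalAtlas he).contMDiffAt (e.open_target.mem_nhds hex)
    have h2 : ContMDiffAt (𝓡 m) 𝓘(ℝ, EuclideanSpace ℝ (Fin n) × F) ∞ c.chart (e.symm (e x)) := by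
      rw [e.left_inv hxe]
      exact c.smooth.contMDiffAt (c.chart.open_source.mem_nhds hxc)
    exact (contMDiffAt_iff_contDiffAt.1 (h2.comp (e x) h1)).differentiableAt (by simp)
  rw [← hAx] at hH hx0 ⊢
  have hL := (hH.comp (e x) hA).hasFDerivAt.clm_apply
    (((ContinuousLinearMap.snd ℝ (EuclideanSpace ℝ (Fin n)) F).hasFDerivAt).comp (e x)
      hA.hasFDerivAt)
  have h3 : (fun w a => V a (e.symm w)) =ᶠ[nhds (e x)]
      fun w => (H ∘ A) w ((ContinuousLinearMap.snd ℝ (EuclideanSpace ℝ (Fin n)) F ∘ A) w) := by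
    have h4 : Filter.Tendsto e.symm (nhds (e x)) (nhds x) := by
      have h5 := e.symm.continuousAt hex
      rwa [ContinuousAt, e.left_inv hxe] at h5
    filter_upwards [h4 (c.chart.open_source.mem_nhds hxc)] with w hw
    exact hVH _ hw
  have h4 := jacobian_rank_le (hL.congr_of_eventuallyEq h3)
  have h5 := hrank.trans (h4.trans (Submodule.finrank_mono
    (t := LinearMap.range (H (A (e x))).toLinearMap) ?_))
  · have h6 := LinearMap.finrank_range_add_finrank_ker (H (A (e x))).toLinearMap
    exact Submodule.finrank_eq_zero.1 (by omega)
  · rintro _ ⟨w, rfl⟩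
    refine ⟨(fderiv ℝ A (e x) w).2, ?_⟩
    -- The product-rule term containing the derivative of `H` is evaluated at the second coordinate,
    -- which is zero here.
    have h7 : (ContinuousLinearMap.snd ℝ (EuclideanSpace ℝ (Fin n)) F ∘ A) (e x) = 0 := hx0
    rw [h7]
    simp

/-- Near a point of `N` where the Jacobian of the defining functions `V_a` has maximal rank, every
smooth function that vanishes on `N` is a combination of the `V_a`. -/
theorem exists_retraction_and_division [IsManifold (𝓡 m) ∞ M] [IsManifold (𝓡 n) ∞ N]
    (hi : Manifold.IsSmoothEmbedding (𝓡 n) (𝓡 m) ∞ i)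
    {e : OpenPartialHomeomorph M (EuclideanSpace ℝ (Fin m))}
    (he : e ∈ IsManifold.maximalAtlas (𝓡 m) ∞ M) {r : ℕ} {V : Fin r → M → ℝ}
    (hV : ∀ a, ContMDiffOn (𝓡 m) 𝓘(ℝ, ℝ) ∞ (V a) (patch e))
    (hV0 : ∀ y, i y ∈ e.source → ∀ a, V a (i y) = 0) {y : N} (hy : i y ∈ e.source)
    (hrank : (jacobian e V (i y)).rank + n = m) {O : Opens M} (hO : i y ∈ O) :
    ∃ (W : Opens M) (ρ : M → N), i y ∈ W ∧ W ≤ O ∧ ContMDiffOn (𝓡 m) (𝓡 n) ∞ ρ W ∧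
      (∀ x ∈ W, i (ρ x) ∈ W) ∧ (∀ y', i y' ∈ W → ρ (i y') = y') ∧
      ∀ g : M → ℝ, ContMDiffOn (𝓡 m) 𝓘(ℝ, ℝ) ∞ g W → (∀ y', i y' ∈ W → g (i y') = 0) →
        ∃ c : Fin r → M → ℝ, (∀ a, ContMDiffOn (𝓡 m) 𝓘(ℝ, ℝ) ∞ (c a) W) ∧
          ∀ x ∈ W, g x = ∑ a, c a x * V a x := by
  obtain ⟨F, _, _, _, c₀, hF, hy₀, hO₀⟩ := exists_sliceChart hi y
    (Filter.inter_mem (e.open_source.mem_nhds hy) (O.2.mem_nhds hO))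
  obtain ⟨c₁, u₁, r₁, ht₁, -, hy₁, hs₁, hc₁, hchart₁, hsymm₁⟩ :=
    c₀.exists_ball hy₀ Filter.univ_mem
  have hs₁' : c₁.chart.source ⊆ patch e := fun x hx => (hO₀ (hs₁ hx)).1
  obtain ⟨H, hH, hVH⟩ := c₁.exists_eq_apply_snd ht₁ (g := fun x a => V a x)
    (contMDiffOn_pi_space.2 fun a => (hV a).mono hs₁')
    (fun y' hy' => funext fun a => hV0 y' (hs₁' hy') a)
  have hmem₁ : c₁.chart (i y) ∈ ball (u₁, (0 : F)) r₁ := ht₁ ▸ c₁.chart.map_source hy₁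
  have hker := c₁.ker_eq_bot he hy hy₁
    ((hH.contDiffAt (isOpen_ball.mem_nhds hmem₁)).differentiableAt (by simp))
    (by rw [hc₁]) hVH (by omega)
  -- `L` inverts `H` on the left at `i y` only. Nearby, `K z = L ∘ H z` is an endomorphism of `F`
  -- close to the identity, hence a unit, and `K⁻¹ L` is a smooth left inverse of `H`.
  obtain ⟨L', hL'⟩ := LinearMap.exists_leftInverse_of_injective _ hker
  let L : (Fin r → ℝ) →L[ℝ] F := L'.toContinuousLinearMap
  let K : EuclideanSpace ℝ (Fin n) × F → F →L[ℝ] F := fun z => L.comp (H z)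
  have hK : ContDiffOn ℝ ∞ K (ball (u₁, 0) r₁) := contDiffOn_const.clm_comp hH
  have hK1 : K (c₁.chart (i y)) = 1 := by
    ext v
    exact LinearMap.congr_fun hL' v
  have hunit : K ⁻¹' {k | IsUnit k} ∈ nhds (c₁.chart (i y)) := by
    refine (hK.continuousOn.continuousAt (isOpen_ball.mem_nhds hmem₁)).preimage_mem_nhds
      (Units.isOpen.mem_nhds ?_)
    rw [Set.mem_ofPred_eq, hK1]
    exact isUnit_one
  obtain ⟨c, u, s, ht, htO, hyc, hs, -, hchart, -⟩ := c₁.exists_ball hy₁ hunit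
  have hinv : ContDiffOn ℝ ∞ (fun z => Ring.inverse (K z)) c.chart.target := by
    intro z hz
    obtain ⟨k, hk⟩ := (htO hz).2
    have h1 : ContDiffAt ℝ ∞ Ring.inverse (K z) := hk ▸ contDiffAt_ringInverse ℝ k
    exact (h1.comp z (hK.contDiffAt (isOpen_ball.mem_nhds (ht₁ ▸ (htO hz).1)))).contDiffWithinAt
  refine ⟨c.domain, c.retraction, hyc, fun x hx => (hO₀ (hs₁ (hs hx))).2,
    c.retraction_smooth ht, fun x hx => c.apply_retraction ht hx,
    fun y' hy' => c.retraction_apply hy', fun g hg hg0 => ?_⟩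
  obtain ⟨D, hD, hgD⟩ := c.exists_eq_apply_snd ht hg hg0
  rw [← ht] at hD
  -- From `g = D(z) z₂` and `z₂ = K⁻¹ L V`, the coefficient of `V_a` is `D K⁻¹ L` on the `a`-th unit
  -- vector.
  have hcoef : ∀ a, ContDiffOn ℝ ∞
      (fun z => D z (Ring.inverse (K z) (L (Pi.single a 1)))) c.chart.target := fun a =>
    hD.clm_apply (hinv.clm_apply contDiffOn_const)
  refine ⟨fun a x => D (c.chart x) (Ring.inverse (K (c.chart x)) (L (Pi.single a 1))),
    fun a => (hcoef a).contMDiffOn.comp c.smooth fun x hx => c.chart.map_source hx,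
    fun x hx => ?_⟩
  have hv : (c.chart x).2 = Ring.inverse (K (c.chart x)) (L fun a => V a x) := by
    rw [hVH x (hs hx), ← hchart]
    have h2 := Ring.inverse_mul_cancel _ (htO (c.chart.map_source hx)).2
    exact (DFunLike.congr_fun h2 (c.chart x).2).symm
  rw [hgD x hx]
  conv_lhs => rw [hv, pi_eq_sum_univ' fun a => V a x]
  simp only [map_sum, map_smul, smul_eq_mul, mul_comm]

end Division

end SuperGeom

namespace SuperGeom

/-! ### The ideal generated by the `V_a` and `dV_a` -/

section Ideal

variable {m : ℕ} {M : Type u} [TopologicalSpace M] [ChartedSpace (EuclideanSpace ℝ (Fin m)) M]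

/-- A smooth function as a differential form. -/
def funForm {W : Opens M} {g : M → ℝ} (hg : ContMDiffOn (𝓡 m) 𝓘(ℝ, ℝ) ∞ g W) : forms m W :=
  ⟨fun x => algebraMap ℝ (Fibre m (x : M)) (g x),
    isSmoothForm_of_mem_adjoin (Algebra.subset_adjoin ⟨g, hg, Or.inl rfl⟩)⟩

/-- The differential of a smooth function as a differential form. -/
def diffForm {W : Opens M} {g : M → ℝ} (hg : ContMDiffOn (𝓡 m) 𝓘(ℝ, ℝ) ∞ g W) : forms m W :=
  ⟨fun x => ExteriorAlgebra.ι ℝ (differential m g (x : M)),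
    isSmoothForm_of_mem_adjoin (Algebra.subset_adjoin ⟨g, hg, Or.inr rfl⟩)⟩

theorem forms_induction {W : Opens M} {p : forms m W → Prop}
    (hfun : ∀ (g : M → ℝ) (hg : ContMDiffOn (𝓡 m) 𝓘(ℝ, ℝ) ∞ g W), p (funForm hg))
    (hdiff : ∀ (g : M → ℝ) (hg : ContMDiffOn (𝓡 m) 𝓘(ℝ, ℝ) ∞ g W), p (diffForm hg))
    (hadd : ∀ f g, p f → p g → p (f + g)) (hmul : ∀ f g, p f → p g → p (f * g))
    {f : forms m W} (hf : f.1 ∈ Algebra.adjoin ℝ (generators m W)) : p f := by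
  refine Algebra.adjoin_induction (R := ℝ)
    (p := fun s hs => p ⟨s, isSmoothForm_of_mem_adjoin hs⟩) ?_ ?_ ?_ ?_ hf
  · rintro _ ⟨g, hg, rfl | rfl⟩
    · exact hfun g hg
    · exact hdiff g hg
  · exact fun c => hfun (fun _ => c) contMDiffOn_const
  · exact fun s t _ _ hs ht => hadd _ _ hs ht
  · exact fun s t _ _ hs ht => hmul _ _ hs ht

theorem sub_mul_mem {A : Type*} [Ring A] {I : Ideal A} {f g f' g' : A}
    (hI : ∀ x ∈ I, x * g' ∈ I) (hf : f - f' ∈ I) (hg : g - g' ∈ I) : f * g - f' * g' ∈ I := by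
  have h1 : f * g - f' * g' = f * (g - g') + (f - f') * g' := by noncomm_ring
  rw [h1]
  exact add_mem (Ideal.mul_mem_left _ _ hg) (hI _ hf)

/-- The ideal is only a left ideal, and `f g - f' g' = f (g - g') + (f - f') g'` needs right
multiplication by `g'`. Hence both assertions are carried through the induction together. -/
theorem mul_mem_and_sub_mem {W : Opens M} (I : Ideal (forms m W))
    (π : forms m W →ₐ[ℝ] forms m W)
    (hfun : ∀ (g : M → ℝ) (hg : ContMDiffOn (𝓡 m) 𝓘(ℝ, ℝ) ∞ g W),
      (∀ x ∈ I, x * π (funForm hg) ∈ I) ∧ funForm hg - π (funForm hg) ∈ I)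
    (hdiff : ∀ (g : M → ℝ) (hg : ContMDiffOn (𝓡 m) 𝓘(ℝ, ℝ) ∞ g W),
      (∀ x ∈ I, x * π (diffForm hg) ∈ I) ∧ diffForm hg - π (diffForm hg) ∈ I)
    {f : forms m W} (hf : f.1 ∈ Algebra.adjoin ℝ (generators m W)) :
    (∀ x ∈ I, x * π f ∈ I) ∧ f - π f ∈ I := by
  refine forms_induction (p := fun f => (∀ x ∈ I, x * π f ∈ I) ∧ f - π f ∈ I)
    hfun hdiff ?_ ?_ hf
  · rintro f g ⟨hf1, hf2⟩ ⟨hg1, hg2⟩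
    rw [map_add]
    refine ⟨fun x hx => ?_, ?_⟩
    · rw [mul_add]
      exact add_mem (hf1 x hx) (hg1 x hx)
    · rw [add_sub_add_comm]
      exact add_mem hf2 hg2
  · rintro f g ⟨hf1, hf2⟩ ⟨hg1, hg2⟩
    rw [map_mul]
    refine ⟨fun x hx => ?_, sub_mul_mem hg1 hf2 hg2⟩
    rw [← mul_assoc]
    exact hg1 _ (hf1 x hx)

theorem funForm_mul_comm {W : Opens M} {g : M → ℝ} (hg : ContMDiffOn (𝓡 m) 𝓘(ℝ, ℝ) ∞ g W)
    (f : forms m W) : funForm hg * f = f * funForm hg :=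
  Subtype.ext (funext fun x => Algebra.commutes (g x) (f.1 x))

theorem diffForm_mul_diffForm {W : Opens M} {g h : M → ℝ}
    (hg : ContMDiffOn (𝓡 m) 𝓘(ℝ, ℝ) ∞ g W) (hh : ContMDiffOn (𝓡 m) 𝓘(ℝ, ℝ) ∞ h W) :
    diffForm hg * diffForm hh = -(diffForm hh * diffForm hg) :=
  Subtype.ext (funext fun _ => eq_neg_of_add_eq_zero_left (ExteriorAlgebra.ι_add_mul_swap _ _))

/-- The left ideal generated by functions `V_a` and their differentials. -/
def equationIdeal {W : Opens M} {r : ℕ} {V : Fin r → M → ℝ}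
    (hV : ∀ a, ContMDiffOn (𝓡 m) 𝓘(ℝ, ℝ) ∞ (V a) W) : Ideal (forms m W) :=
  Ideal.span (Set.range (Sum.elim (fun a => funForm (hV a)) fun a => diffForm (hV a)))

section

variable {W : Opens M} {r : ℕ} {V : Fin r → M → ℝ}
  (hV : ∀ a, ContMDiffOn (𝓡 m) 𝓘(ℝ, ℝ) ∞ (V a) W)

theorem funForm_mem_equationIdeal (a : Fin r) : funForm (hV a) ∈ equationIdeal hV :=
  Ideal.subset_span ⟨Sum.inl a, rfl⟩

theorem diffForm_mem_equationIdeal (a : Fin r) : diffForm (hV a) ∈ equationIdeal hV :=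
  Ideal.subset_span ⟨Sum.inr a, rfl⟩

theorem mul_funForm_mem {g : M → ℝ} (hg : ContMDiffOn (𝓡 m) 𝓘(ℝ, ℝ) ∞ g W) {x : forms m W}
    (hx : x ∈ equationIdeal hV) : x * funForm hg ∈ equationIdeal hV := by
  rw [← funForm_mul_comm]
  exact Ideal.mul_mem_left _ _ hx

/-- The generators commute or anticommute with `dg`, so it can be moved to the left of them. -/
theorem mul_diffForm_mem {g : M → ℝ} (hg : ContMDiffOn (𝓡 m) 𝓘(ℝ, ℝ) ∞ g W) {x : forms m W}
    (hx : x ∈ equationIdeal hV) : x * diffForm hg ∈ equationIdeal hV := by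
  induction hx using Submodule.span_induction with
  | mem x hx =>
    obtain ⟨a | a, rfl⟩ := hx
    · rw [Sum.elim_inl, funForm_mul_comm]
      exact Ideal.mul_mem_left _ _ (funForm_mem_equationIdeal hV a)
    · rw [Sum.elim_inr, diffForm_mul_diffForm]
      exact neg_mem (Ideal.mul_mem_left _ _ (diffForm_mem_equationIdeal hV a))
  | zero =>
    rw [zero_mul]
    exact zero_mem _
  | add x y _ _ hx hy =>
    rw [add_mul]
    exact add_mem hx hy
  | smul c x _ hx =>
    rw [smul_eq_mul, mul_assoc]
    exact Ideal.mul_mem_left _ _ hx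

theorem funForm_mem_of_eq_sum {g : M → ℝ} (hg : ContMDiffOn (𝓡 m) 𝓘(ℝ, ℝ) ∞ g W)
    {c : Fin r → M → ℝ} (hc : ∀ a, ContMDiffOn (𝓡 m) 𝓘(ℝ, ℝ) ∞ (c a) W)
    (hgc : ∀ x ∈ W, g x = ∑ a, c a x * V a x) : funForm hg ∈ equationIdeal hV := by
  have h1 : funForm hg = ∑ a, funForm (hc a) * funForm (hV a) := by
    refine Subtype.ext (funext fun x => ?_)
    rw [AddSubmonoidClass.coe_finsetSum, Finset.sum_apply]
    change algebraMap ℝ (Fibre m (x : M)) (g x) =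
      ∑ a, algebraMap ℝ (Fibre m (x : M)) (c a x) * algebraMap ℝ (Fibre m (x : M)) (V a x)
    rw [hgc x x.2, map_sum]
    exact Finset.sum_congr rfl fun a _ => map_mul _ _ _
  rw [h1]
  exact sum_mem fun a _ => Ideal.mul_mem_left _ _ (funForm_mem_equationIdeal hV a)

/-- Leibniz: `dg = ∑ (c_a dV_a + dc_a V_a)`. The first terms are why the odd equations are needed
besides the even ones. -/
theorem diffForm_mem_of_eq_sum {g : M → ℝ} (hg : ContMDiffOn (𝓡 m) 𝓘(ℝ, ℝ) ∞ g W)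
    {c : Fin r → M → ℝ} (hc : ∀ a, ContMDiffOn (𝓡 m) 𝓘(ℝ, ℝ) ∞ (c a) W)
    (hgc : ∀ x ∈ W, g x = ∑ a, c a x * V a x) : diffForm hg ∈ equationIdeal hV := by
  have h1 : diffForm hg = ∑ a, (funForm (hc a) * diffForm (hV a) +
      diffForm (hc a) * funForm (hV a)) := by
    refine Subtype.ext (funext fun x => ?_)
    rw [AddSubmonoidClass.coe_finsetSum, Finset.sum_apply]
    change ExteriorAlgebra.ι ℝ (differential m g (x : M)) =
      ∑ a, (algebraMap ℝ (Fibre m (x : M)) (c a x) *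
        ExteriorAlgebra.ι ℝ (differential m (V a) (x : M)) +
        ExteriorAlgebra.ι ℝ (differential m (c a) (x : M)) *
          algebraMap ℝ (Fibre m (x : M)) (V a x))
    have hcd := fun a => mdifferentiableAt_of_contMDiffOn (hc a) x.2
    have hVd := fun a => mdifferentiableAt_of_contMDiffOn (hV a) x.2
    have h2 : differential m g (x : M) = ∑ a, (c a x • differential m (V a) (x : M) +
        V a x • differential m (c a) (x : M)) := by
      rw [differential_congr (g' := fun y => ∑ a, c a y * V a y)
        (by filter_upwards [W.2.mem_nhds x.2] with y hy using hgc y hy),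
        differential_sum (g := fun a y => c a y * V a y) _ fun a _ => (hcd a).mul (hVd a)]
      exact Finset.sum_congr rfl fun a _ => differential_mul (hcd a) (hVd a)
    rw [h2]
    refine (map_sum (ExteriorAlgebra.ι ℝ) _ _).trans (Finset.sum_congr rfl fun a _ => ?_)
    refine (map_add (ExteriorAlgebra.ι ℝ) _ _).trans ?_
    rw [map_smul, map_smul, ← Algebra.commutes, ← Algebra.smul_def, ← Algebra.smul_def]
  rw [h1]
  exact sum_mem fun a _ => add_mem
    (Ideal.mul_mem_left _ _ (diffForm_mem_equationIdeal hV a))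
    (Ideal.mul_mem_left _ _ (funForm_mem_equationIdeal hV a))

end

/-! ### Comparing a form with its pullback along the retraction -/

section Embedded

variable {n : ℕ} {N : Type v} [TopologicalSpace N] [ChartedSpace (EuclideanSpace ℝ (Fin n)) N]

theorem formsPullback_funForm {h : M → N} {W : Opens M} {V : Opens N} (hWV : ∀ x ∈ W, h x ∈ V)
    (hh : ContMDiffOn (𝓡 m) (𝓡 n) ∞ h W) {g : N → ℝ} (hg : ContMDiffOn (𝓡 n) 𝓘(ℝ, ℝ) ∞ g V) :
    formsPullback hWV hh (funForm hg) = funForm (hg.comp hh hWV) :=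
  Subtype.ext (rawPullback_fun hWV g)

theorem formsPullback_diffForm {h : M → N} {W : Opens M} {V : Opens N} (hWV : ∀ x ∈ W, h x ∈ V)
    (hh : ContMDiffOn (𝓡 m) (𝓡 n) ∞ h W) {g : N → ℝ} (hg : ContMDiffOn (𝓡 n) 𝓘(ℝ, ℝ) ∞ g V) :
    formsPullback hWV hh (diffForm hg) = diffForm (hg.comp hh hWV) :=
  Subtype.ext (rawPullback_diff hWV hh hg)

theorem funForm_sub {W : Opens M} {g h : M → ℝ} (hg : ContMDiffOn (𝓡 m) 𝓘(ℝ, ℝ) ∞ g W)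
    (hh : ContMDiffOn (𝓡 m) 𝓘(ℝ, ℝ) ∞ h W) :
    funForm hg - funForm hh = funForm (hg.sub hh) :=
  Subtype.ext (funext fun x => (map_sub (algebraMap ℝ (Fibre m (x : M))) _ _).symm)

theorem diffForm_sub {W : Opens M} {g h : M → ℝ} (hg : ContMDiffOn (𝓡 m) 𝓘(ℝ, ℝ) ∞ g W)
    (hh : ContMDiffOn (𝓡 m) 𝓘(ℝ, ℝ) ∞ h W) :
    diffForm hg - diffForm hh = diffForm (hg.sub hh) := by
  refine Subtype.ext (funext fun x => ?_)
  refine (map_sub (ExteriorAlgebra.ι ℝ) _ _).symm.trans (congrArg (ExteriorAlgebra.ι ℝ) ?_)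
  exact (differential_sub (mdifferentiableAt_of_contMDiffOn hg x.2)
    (mdifferentiableAt_of_contMDiffOn hh x.2)).symm

variable {i : N → M}

set_option maxHeartbeats 800000 in
/-- A form differs from its pullback along a retraction `ρ` onto `N` by an element of the ideal
generated by the equations of `N`. -/
theorem sub_formsPullback_mem (hi : ContMDiff (𝓡 n) (𝓡 m) ∞ i) {W : Opens M} {r : ℕ} {V : Fin r → M → ℝ}
    (hV : ∀ a, ContMDiffOn (𝓡 m) 𝓘(ℝ, ℝ) ∞ (V a) W) {ρ : M → N}
    (hρ : ContMDiffOn (𝓡 m) (𝓡 n) ∞ ρ W) {W' : Opens N} (hiW : ∀ y ∈ W', i y ∈ W)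
    (hρW : ∀ x ∈ W, ρ x ∈ W') (hρi : ∀ y, i y ∈ W → ρ (i y) = y)
    (hdiv : ∀ g : M → ℝ, ContMDiffOn (𝓡 m) 𝓘(ℝ, ℝ) ∞ g W → (∀ y, i y ∈ W → g (i y) = 0) →
        ∃ c : Fin r → M → ℝ, (∀ a, ContMDiffOn (𝓡 m) 𝓘(ℝ, ℝ) ∞ (c a) W) ∧
          ∀ x ∈ W, g x = ∑ a, c a x * V a x)
    {f : forms m W} (hf : f.1 ∈ Algebra.adjoin ℝ (generators m W)) :
    f - formsPullback hρW hρ (formsPullback hiW hi.contMDiffOn f) ∈ equationIdeal hV := by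
  have hsmooth : ∀ g : M → ℝ, ContMDiffOn (𝓡 m) 𝓘(ℝ, ℝ) ∞ g W →
      ContMDiffOn (𝓡 m) 𝓘(ℝ, ℝ) ∞ ((g ∘ i) ∘ ρ) W := fun g hg =>
    (hg.comp hi.contMDiffOn hiW).comp hρ hρW
  -- The difference `g - g ∘ i ∘ ρ` vanishes on `N` because `ρ ∘ i = id`, so it is divisible by the
  -- `V_a`; the same coefficients serve for its differential.
  have hcoef : ∀ (g : M → ℝ) (hg : ContMDiffOn (𝓡 m) 𝓘(ℝ, ℝ) ∞ g W),
      ∃ c : Fin r → M → ℝ, (∀ a, ContMDiffOn (𝓡 m) 𝓘(ℝ, ℝ) ∞ (c a) W) ∧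
        ∀ x ∈ W, (g - (g ∘ i) ∘ ρ) x = ∑ a, c a x * V a x := fun g hg =>
    hdiv _ (hg.sub (hsmooth g hg)) fun y hy => by
      simp only [Pi.sub_apply, Function.comp_apply, hρi y hy, sub_self]
  refine (mul_mem_and_sub_mem (equationIdeal hV) ((formsPullback hρW hρ).comp
    (formsPullback hiW hi.contMDiffOn)) ?_ ?_ hf).2
  · intro g hg
    obtain ⟨c, hc, hgc⟩ := hcoef g hg
    have h1 : formsPullback hρW hρ (formsPullback hiW hi.contMDiffOn (funForm hg)) =
        funForm (hsmooth g hg) := by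
      rw [formsPullback_funForm, formsPullback_funForm]
    rw [AlgHom.comp_apply, h1]
    exact ⟨fun x hx => mul_funForm_mem hV (hsmooth g hg) hx,
      Set.mem_of_eq_of_mem (funForm_sub hg (hsmooth g hg))
        (funForm_mem_of_eq_sum hV (hg.sub (hsmooth g hg)) hc hgc)⟩
  · intro g hg
    obtain ⟨c, hc, hgc⟩ := hcoef g hg
    have h1 : formsPullback hρW hρ (formsPullback hiW hi.contMDiffOn (diffForm hg)) =
        diffForm (hsmooth g hg) := by
      rw [formsPullback_diffForm, formsPullback_diffForm]
    rw [AlgHom.comp_apply, h1]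
    exact ⟨fun x hx => mul_diffForm_mem hV (hsmooth g hg) hx,
      Set.mem_of_eq_of_mem (diffForm_sub hg (hsmooth g hg))
        (diffForm_mem_of_eq_sum hV (hg.sub (hsmooth g hg)) hc hgc)⟩

/-- The pullback of a form lying in the ideal generated by functions vanishing on `N` and their
differentials vanishes. -/
theorem formsPullback_apply_eq_zero (hi : ContMDiff (𝓡 n) (𝓡 m) ∞ i) {W : Opens M} {r : ℕ} {V : Fin r → M → ℝ}
    (hV : ∀ a, ContMDiffOn (𝓡 m) 𝓘(ℝ, ℝ) ∞ (V a) W) {W' : Opens N} (hiW : ∀ y ∈ W', i y ∈ W)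
    (hV0 : ∀ y ∈ W', ∀ a, V a (i y) = 0) {f : forms m W} (hf : f ∈ equationIdeal hV) :
    formsPullback hiW hi.contMDiffOn f = 0 := by
  have h1 : equationIdeal hV ≤ RingHom.ker (formsPullback hiW hi.contMDiffOn) := by
    refine Ideal.span_le.2 ?_
    rintro _ ⟨a | a, rfl⟩
    · rw [SetLike.mem_coe, RingHom.mem_ker, Sum.elim_inl, formsPullback_funForm]
      refine Subtype.ext (funext fun y => ?_)
      change algebraMap ℝ (Fibre n (y : N)) (V a (i y)) = 0
      rw [hV0 y y.2, map_zero]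
    · rw [SetLike.mem_coe, RingHom.mem_ker, Sum.elim_inr, formsPullback_diffForm]
      refine Subtype.ext (funext fun y => ?_)
      change ExteriorAlgebra.ι ℝ (differential n (V a ∘ i) (y : N)) = 0
      rw [differential_congr (g' := fun _ => 0)
        (by filter_upwards [W'.2.mem_nhds y.2] with z hz using hV0 z hz a),
        differential_zero_fun, map_zero]
  exact h1 hf

/-- Functoriality `i^* ρ^* = (ρ ∘ i)^*` with `ρ ∘ i = id`, checked on functions and differentials.
It makes `ρ^*` a local section of `i^*`. -/
theorem rawPullback_rawPullback_eq_rawRes (hi : ContMDiff (𝓡 n) (𝓡 m) ∞ i) {V W' : Opens N} {W : Opens M} {ρ : M → N}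
    (hρ : ContMDiffOn (𝓡 m) (𝓡 n) ∞ ρ W) (hρW : ∀ x ∈ W, ρ x ∈ V) (hiW : ∀ y ∈ W', i y ∈ W)
    (hW' : W' ≤ V) (hρi : ∀ y ∈ W', ρ (i y) = y) {f : RawForm n V}
    (hf : f ∈ Algebra.adjoin ℝ (generators n V)) :
    rawPullback (m := n) (n := m) i hiW (rawPullback (m := m) (n := n) ρ hρW f) = rawRes hW' f := by
  have h1 : Algebra.adjoin ℝ (generators n V) ≤
      AlgHom.equalizer ((rawPullback (m := n) (n := m) i hiW).comp
        (rawPullback (m := m) (n := n) ρ hρW)) (rawRes hW') := by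
    refine Algebra.adjoin_le ?_
    rintro _ ⟨g, hg, rfl | rfl⟩
    · rw [SetLike.mem_coe, AlgHom.mem_equalizer, AlgHom.comp_apply, rawPullback_fun,
        rawPullback_fun]
      funext y
      simp only [Function.comp_apply, hρi y y.2]
      rfl
    · rw [SetLike.mem_coe, AlgHom.mem_equalizer, AlgHom.comp_apply, rawPullback_diff hρW hρ hg,
        rawPullback_diff hiW hi.contMDiffOn (hg.comp hρ hρW)]
      funext y
      rw [differential_congr (g' := g) (by
        filter_upwards [W'.2.mem_nhds y.2] with z hz
        simp only [Function.comp_apply, hρi z hz])]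
      rfl
  exact h1 hf

end Embedded

end Ideal

/-! ### Sub-supermanifold and equations -/

section Main

variable {m n : ℕ} {M : Type u} [TopologicalSpace M] [ChartedSpace (EuclideanSpace ℝ (Fin m)) M]
  [IsManifold (𝓡 m) ∞ M] {N : Type v} [TopologicalSpace N]
  [ChartedSpace (EuclideanSpace ℝ (Fin n)) N] [IsManifold (𝓡 n) ∞ N] {i : N → M}

theorem isSubSupermanifold_pullbackHom (hi : Manifold.IsSmoothEmbedding (𝓡 n) (𝓡 m) ∞ i) :
    (pullbackHom i hi.contMDiff).IsSubSupermanifold n m where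
  source := isSupermanifold_tautological n N
  target := isSupermanifold_tautological m M
  isSmoothEmbedding := hi
  surjective_germs V y hy b := by
    let b' : forms n V := b
    obtain ⟨V₁, hV₁, hyV₁, hb⟩ := b'.2 y hy
    -- Choosing the slice chart inside `O` forces the retraction to land in `V₁`, where the form is
    -- a polynomial in generators.
    obtain ⟨O, hO, hOV₁⟩ := hi.isEmbedding.isInducing.isOpen_iff.1 V₁.2
    have hmem : ∀ z, i z ∈ O ↔ z ∈ V₁ := fun z => Set.ext_iff.1 hOV₁ z
    obtain ⟨F, _, _, _, c₀, -, hy₀, hO₀⟩ := exists_sliceChart hi y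
      (hO.mem_nhds ((hmem y).2 hyV₁))
    obtain ⟨c, u, r, ht, -, hyc, hs, -⟩ := c₀.exists_ball hy₀ Filter.univ_mem
    have hρW : ∀ x ∈ c.domain, c.retraction x ∈ V₁ := fun x hx =>
      (hmem _).1 (hO₀ (hs (c.apply_retraction ht hx)))
    let a : forms m c.domain := formsPullback hρW (c.retraction_smooth ht) (formsRes hV₁ b')
    let W : Opens N := (pullbackHom i hi.contMDiff).preimage c.domain
    have hWV₁ : W ≤ V₁ := fun z hz => (hmem z).1 (hO₀ (hs hz))
    refine ⟨c.domain, hyc, a, W, hyc, hWV₁.trans hV₁, le_rfl, ?_⟩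
    exact Subtype.ext (a1 := formsPullback (h := i) (W := W) (V := c.domain) (fun _ hz => hz) hi.contMDiff.contMDiffOn a)
      (a2 := formsRes (hWV₁.trans hV₁) b')
      (rawPullback_rawPullback_eq_rawRes hi.contMDiff (c.retraction_smooth ht) hρW
        (fun _ hz => hz) hWV₁ (fun z hz => c.retraction_apply hz) hb)

variable {e : OpenPartialHomeomorph M (EuclideanSpace ℝ (Fin m))}
  (he : e ∈ IsManifold.maximalAtlas (𝓡 m) ∞ M)

/-- This turns the coordinate expression into the intrinsic `dg`, which is compatible with pullback
and the Leibniz rule. -/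
theorem fermionic_eq_ofDiff {g : M → ℝ} (hg : ContMDiffOn (𝓡 m) 𝓘(ℝ, ℝ) ∞ g (patch e)) :
    fermionic he g hg = ofDiff (patch e) g hg := by
  have h1 : (∑ k : Fin m, funForm (partialDeriv_smooth he hg k) * diffForm (coord_smooth he k)) =
      diffForm hg := by
    refine Subtype.ext (funext fun x => ?_)
    rw [AddSubmonoidClass.coe_finsetSum, Finset.sum_apply]
    change _ = ExteriorAlgebra.ι ℝ (differential m g (x : M))
    rw [differential_eq_sum he x.2 (mdifferentiableAt_of_contMDiffOn hg x.2)]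
    refine Eq.trans (Finset.sum_congr rfl fun k _ => ?_) (map_sum (ExteriorAlgebra.ι ℝ) _ _).symm
    rw [map_smul, Algebra.smul_def]
    rfl
  exact h1

theorem isGivenByEquations_pullbackHom (hi : Manifold.IsSmoothEmbedding (𝓡 n) (𝓡 m) ∞ i)
    {r : ℕ} {V : Fin r → M → ℝ} (hV : ∀ a, ContMDiffOn (𝓡 m) 𝓘(ℝ, ℝ) ∞ (V a) (patch e))
    (hzero : ∀ x ∈ e.source, x ∈ Set.range i ↔ ∀ a, V a x = 0)
    (hrank : ∀ x ∈ e.source, x ∈ Set.range i → (jacobian e V x).rank + n = m) :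
    (pullbackHom i hi.contMDiff).IsGivenByEquations (patch e)
      (Sum.elim (fun a => ofFun (patch e) (V a) (hV a)) fun a => fermionic he (V a) (hV a)) := by
  simp only [fermionic_eq_ofDiff]
  have hspan : ∀ (W : Opens M) (hW : W ≤ patch e),
      Ideal.span (Set.range fun j => (tautological m M).res hW
        (Sum.elim (fun a => ofFun (patch e) (V a) (hV a))
          (fun a => ofDiff (patch e) (V a) (hV a)) j)) =
      equationIdeal (W := W) fun a => (hV a).mono hW := by
    intro W hW
    refine congrArg Ideal.span (congrArg Set.range (funext fun j => ?_))
    rcases j with a | a <;> rfl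
  constructor
  · intro p
    rw [show (p : M) ∈ Set.range (pullbackHom i hi.contMDiff).base ↔ _ from hzero p p.2]
    constructor
    · rintro h (a | a)
      · exact (ExteriorAlgebra.algebraMap_leftInverse _ _).trans (h a)
      · change ExteriorAlgebra.algebraMapInv
          (ExteriorAlgebra.ι ℝ (differential m (V a) (p : M))) = 0
        simp [ExteriorAlgebra.algebraMapInv]
    · exact fun h a => (ExteriorAlgebra.algebraMap_leftInverse _ _).symm.trans (h (Sum.inl a))
  · intro U hU f
    let f' : forms m U := f
    let U' : Opens N := (pullbackHom i hi.contMDiff).preimage U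
    have hiU : ∀ y ∈ U', i y ∈ U := fun _ hy => hy
    change formsPullback hiU hi.contMDiff.contMDiffOn f' = 0 ↔ _
    constructor
    · intro hf p hp
      suffices h : ∃ (W : Opens M) (hW : W ≤ U), p ∈ W ∧
          formsRes hW f' ∈ equationIdeal (W := W) fun a => (hV a).mono (hW.trans hU) by
        obtain ⟨W, hW, hpW, h⟩ := h
        refine ⟨W, hW, hpW, ?_⟩
        rw [hspan]
        exact h
      by_cases hpi : p ∈ Set.range i
      · obtain ⟨y, rfl⟩ := hpi
        obtain ⟨O, hOU, hyO, hfO⟩ := f'.2 _ hp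
        obtain ⟨W, ρ, hyW, hWO, hρ, hiρ, hρi, hdiv⟩ := exists_retraction_and_division hi he hV
          (fun z hz => (hzero _ hz).1 ⟨z, rfl⟩) (hU hp) (hrank _ (hU hp) ⟨y, rfl⟩) hyO
        refine ⟨W, hWO.trans hOU, hyW, ?_⟩
        let W' : Opens N := (pullbackHom i hi.contMDiff).preimage W
        have h1 := sub_formsPullback_mem hi.contMDiff
          (fun a => (hV a).mono ((hWO.trans hOU).trans hU)) hρ (W' := W') (fun _ hz => hz) hiρ
          hρi hdiv (f := formsRes (hWO.trans hOU) f') (rawRes_mem_adjoin hWO hfO)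
        have h2 : formsPullback (h := i) (W := W') (V := W) (fun _ hz => hz) hi.contMDiff.contMDiffOn
            (formsRes (hWO.trans hOU) f') = 0 := by
          refine Subtype.ext (funext fun z => ?_)
          exact congrFun (congrArg Subtype.val hf) ⟨z, hOU (hWO z.2)⟩
        rwa [h2, map_zero, sub_zero] at h1
      · obtain ⟨a, ha⟩ := not_forall.1 fun h => hpi ((hzero p (hU hp)).2 h)
        -- Off `N` some `V_a` is nonzero near `p`, and `f = (f V_a⁻¹) V_a` there.
        have hcont : ContinuousOn (V a) U := (hV a).continuousOn.mono hU
        let W : Opens M := ⟨U ∩ V a ⁻¹' {0}ᶜ, hcont.isOpen_inter_preimage U.2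
          isOpen_compl_singleton⟩
        have hW : W ≤ U := fun _ hx => hx.1
        have hinv : ContMDiffOn (𝓡 m) 𝓘(ℝ, ℝ) ∞ (fun x => (V a x)⁻¹) W :=
          ((hV a).mono (hW.trans hU)).inv₀ fun x hx => hx.2
        refine ⟨W, hW, ⟨hp, ha⟩, ?_⟩
        have h1 : formsRes hW f' = formsRes hW f' * funForm hinv *
            funForm ((hV a).mono (hW.trans hU)) := by
          rw [mul_assoc]
          refine Subtype.ext (funext fun x => ?_)
          change f'.1 ⟨x, hW x.2⟩ = f'.1 ⟨x, hW x.2⟩ *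
            (algebraMap ℝ (Fibre m (x : M)) (V a x)⁻¹ * algebraMap ℝ (Fibre m (x : M)) (V a x))
          rw [← map_mul, inv_mul_cancel₀ x.2.2, map_one, mul_one]
        rw [h1]
        exact Ideal.mul_mem_left _ _ (funForm_mem_equationIdeal _ a)
    · intro h
      refine Subtype.ext (funext fun y => ?_)
      -- Vanishing of the pullback is pointwise on `N`, so local membership in the ideal near `i y`
      -- is enough.
      obtain ⟨W, hW, hyW, hfW⟩ := h (i y) y.2
      rw [hspan W (hW.trans hU)] at hfW
      have h1 := formsPullback_apply_eq_zero hi.contMDiff _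
        (W' := (pullbackHom i hi.contMDiff).preimage W) (fun _ hz => hz)
        (fun z hz => (hzero (i z) (hU (hW hz))).1 ⟨z, rfl⟩) hfW
      exact congrFun (congrArg Subtype.val h1) ⟨y, hyW⟩

end Main

end SuperGeom

end

theorem proposition1 {m n : ℕ}
    {M : Type u} [TopologicalSpace M] [ChartedSpace (EuclideanSpace ℝ (Fin m)) M]
    [IsManifold (𝓡 m) ∞ M]
    {N : Type v} [TopologicalSpace N] [ChartedSpace (EuclideanSpace ℝ (Fin n)) N]
    [IsManifold (𝓡 n) ∞ N]
    (i : N → M) (hi : Manifold.IsSmoothEmbedding (𝓡 n) (𝓡 m) ∞ i) :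
    ∃ φ : SuperGeom.Superspace.Hom (SuperGeom.tautological n N) (SuperGeom.tautological m M),
      ⇑φ.base = i ∧ SuperGeom.IsPullbackOfForms φ ∧ φ.IsSubSupermanifold n m ∧
      ∀ (e : OpenPartialHomeomorph M (EuclideanSpace ℝ (Fin m)))
        (he : e ∈ IsManifold.maximalAtlas (𝓡 m) ∞ M)
        (r : ℕ) (V : Fin r → M → ℝ)
        (hV : ∀ a, ContMDiffOn (𝓡 m) 𝓘(ℝ, ℝ) ∞ (V a) (SuperGeom.patch e)),
        (∀ x ∈ e.source, x ∈ Set.range i ↔ ∀ a, V a x = 0) →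
        (∀ x ∈ e.source, x ∈ Set.range i → (SuperGeom.jacobian e V x).rank + n = m) →
        φ.IsGivenByEquations (SuperGeom.patch e)
          (Sum.elim (fun a => SuperGeom.ofFun (SuperGeom.patch e) (V a) (hV a))
            (fun a => SuperGeom.fermionic he (V a) (hV a))) :=
  ⟨SuperGeom.pullbackHom i hi.contMDiff, rfl, SuperGeom.isPullbackOfForms_pullbackHom i _,
    SuperGeom.isSubSupermanifold_pullbackHom hi, fun _ he _ _ hV hzero hrank =>
      SuperGeom.isGivenByEquations_pullbackHom he hi hV hzero hrank⟩
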